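/- Let $d\ge 1$. For $i=1,\dots,d$ let $\alpha_i\in(1,2)$ and let $d_{i,+},d_{i,-}\ge 0$ be diffusion coefficients with $d_{i,+}+d_{i,-}>0$. Put $$\mu:=\max_{1\le i\le d}\frac{|d_{i,+}-d_{i,-}|}{d_{i,+}+d_{i,-}}\left|\tan\left(\frac{\alpha_i}{2}\pi\right)\right|.$$ For a box $\prod_{i=1}^d(a_i,b_i)$ with $a_i<b_i$, a final time $T>0$, grid sizes $n_1,\dots,n_d\ge 1$ and a number $M\ge 1$ of time steps, let $n=n_1\cdots n_d$, $h_i=(b_i-a_i)/(n_i+1)$, $\nu=M/T$ (the reciprocal of the time step $T/M$), $\widetilde v_{i,\pm}=d_{i,\pm}/h_i^{\alpha_i}$, $n_i^-=\prod_{j<i}n_j$ and $n_i^+=\prod_{j>i}n_j$. Let $\widetilde g_k^{(\alpha)}=(-1)^k\binom{\alpha}{k}$ for $k\ge 0$, and let $\widetilde L_m^{(\alpha)}\in\mathbb R^{m\times m}$ be the shifted Grünwald matrix whose $(j,k)$ entry is $-\widetilde g^{(\alpha)}_{j-k+1}$ if $k\le j+1$ and $0$ otherwise. The coefficient matrix of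 the first-order scheme (backward Euler in time, shifted Grünwald in space) for the Riemann–Liouville space fractional diffusion equation is $$\widetilde A_n=\nu I_n+\sum_{i=1}^d\left(\widetilde v_{i,+}\widetilde W_i+\widetilde v_{i,-}\widetilde W_i^{\top}\right),\qquad \widetilde W_i=I_{n_i^-}\otimes \widetilde L_{n_i}^{(\alpha_i)}\otimes I_{n_i^+}.$$ For a square matrix $Z$ let $\mathcal H(Z)=(Z+Z^\top)/2$, and for a symmetric Toeplitz matrix $T_m$ with first column $(t_1,\dots,t_m)^\top$ let $\tau(T_m)=T_m-H_m$, where $H_m$ is the Hankel matrix with first column $(t_3,\dots,t_m,0,0)^\top$ and last column $(0,0,t_m,\dots,t_3)^\top$ ($H_m=0$ for $m\le 2$). The multilevel Tau preconditioner is $$\widetilde P_n=\nu I_n+\sum_{i=1}^d(\widetilde v_{i,+}+\widetilde v_{i,-})\, I_{n_i^-}\otimes\tau\left(\mathcal H\left(\widetilde L_{n_i}^{(\alpha_i)}\right)\right)\otimes I_{n_i^+}.$$ Finally let $Y_n=Y_{n_1}\otimes\cdots\otimes Y_{n_d}$, where $Y_m$ is the $m\times m$ anti-identity matrix ($[Y_m]_{j,k}=1$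 if $j+k=m+1$, and $0$ otherwise). **Theorem.** There is a real number $\varepsilon$ with $0\le\varepsilon\le\mu$, and with $\varepsilon<\mu$ if $\mu>0$, which depends only on $d$ and on the numbers $\alpha_i,d_{i,+},d_{i,-}$, such that for all boxes, all $T>0$, all $n_1,\dots,n_d\ge1$ and all $M\ge 1$ the matrix $\widetilde P_n$ is invertible and all (complex) eigenvalues of $\widetilde P_n^{-1}Y_n\widetilde A_n$ are real and lie in $$\left(-\tfrac32(1+\varepsilon),-\tfrac12\right)\cup\left(\tfrac12,\tfrac32(1+\varepsilon)\right).$$ -/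

import Mathlib

noncomputable section

namespace FracDiff

open scoped Matrix

/-- The anti-identity matrix: with indices `1, …, m` the `(j, k)` entry is `1` iff `j + k = m + 1`. -/
def antiIdentity (m : ℕ) : Matrix (Fin m) (Fin m) ℝ :=
  Matrix.of fun j k => if (j : ℕ) + (k : ℕ) + 1 = m then 1 else 0

/-- The symmetric part `(Z + Zᵀ) / 2` of a real square matrix. -/
def symmPart {ι : Type*} (Z : Matrix ι ι ℝ) : Matrix ι ι ℝ :=
  (1 / 2 : ℝ) • (Z + Zᵀ)

/-- The first column of `T`, read as a sequence (index starting at `0`) and continued by zero. -/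
def firstColumn {m : ℕ} (T : Matrix (Fin m) (Fin m) ℝ) (s : ℕ) : ℝ :=
  if h : s < m then T ⟨s, h⟩ ⟨0, by omega⟩ else 0

/-- For a Toeplitz matrix `T` with first column `(t₁, …, t_m)`, the Hankel matrix with first
column `(t₃, …, t_m, 0, 0)` and last column `(0, 0, t_m, …, t₃)`. -/
def tauHankel {m : ℕ} (T : Matrix (Fin m) (Fin m) ℝ) : Matrix (Fin m) (Fin m) ℝ :=
  Matrix.of fun j k =>
    firstColumn T ((j : ℕ) + (k : ℕ) + 2) + firstColumn T (2 * m - ((j : ℕ) + (k : ℕ)))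

/-- The `τ`-matrix approximation of a symmetric Toeplitz matrix `T`. -/
def tau {m : ℕ} (T : Matrix (Fin m) (Fin m) ℝ) : Matrix (Fin m) (Fin m) ℝ :=
  T - tauHankel T

/-- The Grünwald coefficients `(-1)^k / k! * α (α - 1) ⋯ (α - k + 1)`. -/
def grunwaldCoeff (α : ℝ) (k : ℕ) : ℝ :=
  (-1) ^ k / (k.factorial : ℝ) * ∏ j ∈ Finset.range k, (α - (j : ℝ))

/-- The shifted Grünwald matrix: the `(j, k)` entry is `-g_{j-k+1}` if `k ≤ j + 1`, and `0` above
the first superdiagonal. -/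
def grunwaldMatrix (α : ℝ) (m : ℕ) : Matrix (Fin m) (Fin m) ℝ :=
  Matrix.of fun j k =>
    if (k : ℕ) ≤ (j : ℕ) + 1 then -grunwaldCoeff α ((j : ℕ) + 1 - (k : ℕ)) else 0

/-- The `d`-fold Kronecker product `B₁ ⊗ ⋯ ⊗ B_d`. Rows and columns are indexed by multi-indices
(the usual numbering by `1, …, n₁ ⋯ n_d` is their lexicographic enumeration). -/
def kron {d : ℕ} {n : Fin d → ℕ} (B : ∀ i, Matrix (Fin (n i)) (Fin (n i)) ℝ) :
    Matrix (∀ i, Fin (n i)) (∀ i, Fin (n i)) ℝ :=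
  Matrix.of fun p q => ∏ i, B i (p i) (q i)

/-- `I ⊗ ⋯ ⊗ I ⊗ B ⊗ I ⊗ ⋯ ⊗ I` with `B` in position `i`. -/
def kronAt {d : ℕ} {n : Fin d → ℕ} (i : Fin d) (B : Matrix (Fin (n i)) (Fin (n i)) ℝ) :
    Matrix (∀ i, Fin (n i)) (∀ i, Fin (n i)) ℝ :=
  kron (Function.update (fun _ => 1) i B)

/-- The multilevel anti-identity `Y_{n₁} ⊗ ⋯ ⊗ Y_{n_d}`. -/
def multiAntiIdentity {d : ℕ} (n : Fin d → ℕ) : Matrix (∀ i, Fin (n i)) (∀ i, Fin (n i)) ℝ :=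
  kron fun i => antiIdentity (n i)

/-- The data of the fractional diffusion equation on `∏ (a_i, b_i) × (0, T]`. -/
structure Problem (d : ℕ) where
  /-- fractional orders -/
  α : Fin d → ℝ
  /-- left diffusion coefficients -/
  dPlus : Fin d → ℝ
  /-- right diffusion coefficients -/
  dMinus : Fin d → ℝ
  /-- left endpoints -/
  a : Fin d → ℝ
  /-- right endpoints -/
  b : Fin d → ℝ
  /-- final time -/
  T : ℝ

namespace Problem

variable {d : ℕ} (p : Problem d)

/-- The mesh size `h_i = (b_i - a_i) / (n_i + 1)`. -/
def h (n : Fin d → ℕ) (i : Fin d) : ℝ := (p.b i - p.a i) / ((n i : ℝ) + 1)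

/-- The time step `T / M`. -/
def timeStep (M : ℕ) : ℝ := p.T / (M : ℝ)

/-- `ν`, the reciprocal of the time step. -/
def nu (M : ℕ) : ℝ := 1 / p.timeStep M

/-- `d_{i,+} / h_i ^ α_i`. -/
def vPlus (n : Fin d → ℕ) (i : Fin d) : ℝ := p.dPlus i / p.h n i ^ p.α i

/-- `d_{i,-} / h_i ^ α_i`. -/
def vMinus (n : Fin d → ℕ) (i : Fin d) : ℝ := p.dMinus i / p.h n i ^ p.α i

/-- The coefficient matrix of the first-order scheme (backward Euler in time, shifted Grünwald
in space). -/
def coeffMatrix (n : Fin d → ℕ) (M : ℕ) : Matrix (∀ i, Fin (n i)) (∀ i, Fin (n i)) ℝ :=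
  p.nu M • 1 + ∑ i, (p.vPlus n i • kronAt i (grunwaldMatrix (p.α i) (n i)) +
    p.vMinus n i • (kronAt i (grunwaldMatrix (p.α i) (n i)))ᵀ)

/-- The multilevel Tau preconditioner of the first-order scheme. -/
def tauPrecond (n : Fin d → ℕ) (M : ℕ) : Matrix (∀ i, Fin (n i)) (∀ i, Fin (n i)) ℝ :=
  p.nu M • 1 + ∑ i, (p.vPlus n i + p.vMinus n i) •
    kronAt i (tau (symmPart (grunwaldMatrix (p.α i) (n i))))

end Problem

/-- `max_i |d_{i,+} - d_{i,-}| / (d_{i,+} + d_{i,-}) * |tan (α_i π / 2)|` (for `d ≥ 1`). -/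
def epsBound {d : ℕ} (α dPlus dMinus : Fin d → ℝ) : ℝ :=
  ⨆ i, |dPlus i - dMinus i| / (dPlus i + dMinus i) * |Real.tan (α i / 2 * Real.pi)|

end FracDiff

end

noncomputable section

namespace FracDiff

open scoped Matrix

/-! Write A, P, Y for the coefficient matrix, the Tau preconditioner and the anti-identity.
Reversing all indices turns A into its transpose and fixes P, so YA is symmetric and Y commutes with
P. As P is positive definite, the pencil (YA, P) has real eigenvalues and real eigenvectors. If YAx
= lPx and u = Yx, then Ax = lPu, while u and x give the same values to the forms of A and of P.

Two estimates then bound |l|. The first is P/2 < A < 3P/2 as quadratic forms: in one dimension it is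
diagonal dominance, based on the signs, monotonicity and sums of the Grünwald coefficients
(`tau_quadForm_bounds`), and strictness comes from the shift ν > 0. Pairing Ax = lPu with x and
using Cauchy–Schwarz for P gives |l| > 1/2.

The second is a sector bound: the numerical range of the Grünwald matrix lies in the sector
containing the values of its symbol -e^{-iθ}(1 - e^{iθ})^α, whose half-angle is π(1 - α/2)
(`symbol_sector`, `grunwaldMatrix_sector`). Weighting the directions by their diffusion coefficients
bounds the skew part of A by μ times its symmetric part, hence (u·Ax)² ≤ (1 + μ²)(u·Au)(x·Ax)
(`sq_bilin_le_of_sector`). Pairing Ax = lPu with u gives |l| < (3/2)√(1 + μ²), so ε = √(1 + μ²) - 1.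
-/

/-! ### Signs, monotonicity and sums of the Grünwald coefficients. -/

theorem grunwaldCoeff_zero (α : ℝ) : grunwaldCoeff α 0 = 1 := by
  simp [grunwaldCoeff]

theorem grunwaldCoeff_succ (α : ℝ) (k : ℕ) :
    ((k : ℝ) + 1) * grunwaldCoeff α (k + 1) = ((k : ℝ) - α) * grunwaldCoeff α k := by
  have h1 : ((k.factorial : ℕ) : ℝ) ≠ 0 := by positivity
  have h2 : ((k : ℝ) + 1) ≠ 0 := by positivity
  simp only [grunwaldCoeff, Finset.prod_range_succ, Nat.factorial_succ, pow_succ]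
  push_cast
  field_simp
  ring

theorem grunwaldCoeff_one (α : ℝ) : grunwaldCoeff α 1 = -α := by
  have := grunwaldCoeff_succ α 0
  simpa [grunwaldCoeff_zero] using this

theorem grunwaldCoeff_two (α : ℝ) : grunwaldCoeff α 2 = α * (α - 1) / 2 := by
  have := grunwaldCoeff_succ α 1
  rw [grunwaldCoeff_one] at this
  norm_num at this
  linarith

theorem grunwaldCoeff_pos {α : ℝ} (h1 : 1 < α) (h2 : α < 2) {k : ℕ} (hk : 2 ≤ k) :
    0 < grunwaldCoeff α k := by
  induction k, hk using Nat.le_induction with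
  | base =>
    rw [grunwaldCoeff_two]
    have : 0 < α - 1 := by linarith
    positivity
  | succ k hk ih =>
    have h := grunwaldCoeff_succ α k
    have hk' : (2 : ℝ) ≤ k := by exact_mod_cast hk
    have : 0 < ((k : ℝ) + 1) * grunwaldCoeff α (k + 1) := by
      rw [h]; exact mul_pos (by linarith) ih
    exact pos_of_mul_pos_right this (by positivity)

theorem grunwaldCoeff_succ_le {α : ℝ} (h1 : 1 < α) (h2 : α < 2) {k : ℕ} (hk : 2 ≤ k) :
    grunwaldCoeff α (k + 1) ≤ grunwaldCoeff α k := by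
  have h := grunwaldCoeff_succ α k
  have := grunwaldCoeff_pos h1 h2 hk
  have hk' : (2 : ℝ) ≤ k := by exact_mod_cast hk
  nlinarith

/-- The closed form follows from the recurrence by induction, and the sign of a partial sum can be
read off from the next coefficient. -/
theorem sum_grunwaldCoeff (α : ℝ) (N : ℕ) :
    α * ∑ k ∈ Finset.range (N + 1), grunwaldCoeff α k =
      -(((N : ℝ) + 1) * grunwaldCoeff α (N + 1)) := by
  induction N with
  | zero => simp [grunwaldCoeff_zero, grunwaldCoeff_one]
  | succ N ih =>
    rw [Finset.sum_range_succ, mul_add, ih, grunwaldCoeff_succ α (N + 1)]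
    push_cast
    ring

theorem sum_grunwaldCoeff_nonpos {α : ℝ} (h1 : 1 < α) (h2 : α < 2) {N : ℕ} (hN : 2 ≤ N) :
    ∑ k ∈ Finset.range N, grunwaldCoeff α k ≤ 0 := by
  obtain ⟨N, rfl⟩ : ∃ k, N = k + 1 := ⟨N - 1, by omega⟩
  have h := sum_grunwaldCoeff α N
  have hg := grunwaldCoeff_pos h1 h2 hN
  have : 0 ≤ ((N : ℝ) + 1) * grunwaldCoeff α (N + 1) := by positivity
  nlinarith

/-- The first column of the symmetric part of the shifted Grünwald matrix. -/
def symmCoeff (α : ℝ) (s : ℕ) : ℝ :=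
  if s = 0 then α else if s = 1 then -(1 + grunwaldCoeff α 2) / 2 else -grunwaldCoeff α (s + 1) / 2

theorem symmCoeff_nonpos {α : ℝ} (h1 : 1 < α) (h2 : α < 2) {s : ℕ} (hs : 1 ≤ s) :
    symmCoeff α s ≤ 0 := by
  have := grunwaldCoeff_pos h1 h2 (k := s + 1) (by omega)
  have := grunwaldCoeff_pos h1 h2 (k := 2) le_rfl
  unfold symmCoeff
  split_ifs <;> first | omega | linarith

theorem symmCoeff_le_succ {α : ℝ} (h1 : 1 < α) (h2 : α < 2) {s : ℕ} (hs : 1 ≤ s) :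
    symmCoeff α s ≤ symmCoeff α (s + 1) := by
  have := grunwaldCoeff_succ_le h1 h2 (k := s + 1) (by omega)
  have h0 : s ≠ 0 := by omega
  by_cases h : s = 1
  · subst h
    norm_num [symmCoeff] at this ⊢
    linarith
  · simp only [symmCoeff, h0, h, Nat.succ_ne_zero, if_false, Nat.add_eq_right]
    linarith

theorem symmCoeff_mono {α : ℝ} (h1 : 1 < α) (h2 : α < 2) {s r : ℕ} (hs : 1 ≤ s) (hr : s ≤ r) :
    symmCoeff α s ≤ symmCoeff α r := by
  induction r, hr using Nat.le_induction with
  | base => exact le_rfl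
  | succ r hr ih => exact ih.trans (symmCoeff_le_succ h1 h2 (hs.trans hr))

theorem sum_symmCoeff {α : ℝ} (m : ℕ) :
    symmCoeff α 0 + 2 * ∑ s ∈ Finset.Ico 1 (m + 2), symmCoeff α s =
      -∑ k ∈ Finset.range (m + 3), grunwaldCoeff α k := by
  induction m with
  | zero =>
    simp [symmCoeff, Finset.sum_range_succ, grunwaldCoeff_zero, grunwaldCoeff_one]
    ring
  | succ m ih =>
    rw [Finset.sum_Ico_succ_top (by omega), Finset.sum_range_succ, mul_add, ← add_assoc, ih]
    simp [symmCoeff]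
    ring

/-- This is the lower bound for the row sums in the diagonal dominance argument, where every nonzero
offset may occur twice. -/
theorem sum_symmCoeff_nonneg {α : ℝ} (h1 : 1 < α) (h2 : α < 2) (m : ℕ) :
    0 ≤ symmCoeff α 0 + 2 * ∑ s ∈ Finset.Ico 1 m, symmCoeff α s := by
  rcases m with _ | _ | m
  · simp [symmCoeff]; linarith
  · simp [symmCoeff]; linarith
  · rw [sum_symmCoeff]
    have := sum_grunwaldCoeff_nonpos h1 h2 (N := m + 3) (by omega)
    linarith

theorem symmPart_grunwaldMatrix_apply (α : ℝ) {m : ℕ} (j k : Fin m) :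
    symmPart (grunwaldMatrix α m) j k = symmCoeff α (((j : ℕ) - k) + ((k : ℕ) - j)) := by
  simp only [symmPart, grunwaldMatrix, Matrix.smul_apply, Matrix.add_apply, Matrix.of_apply,
    Matrix.transpose_apply, smul_eq_mul]
  rcases lt_trichotomy (j : ℕ) k with h | h | h
  · obtain ⟨r, hr⟩ : ∃ r, (k : ℕ) = j + r + 1 := ⟨k - j - 1, by omega⟩
    rw [hr]
    rcases r with _ | r
    · rw [if_pos (by omega), if_pos (by omega), show (j : ℕ) + 1 - (j + 0 + 1) = 0 by omega,
        show (j : ℕ) + 0 + 1 + 1 - j = 2 by omega,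
        show (j : ℕ) - (j + 0 + 1) + (j + 0 + 1 - j) = 1 by omega]
      simp [symmCoeff, grunwaldCoeff_zero]; ring
    · rw [if_neg (by omega), if_pos (by omega),
        show (j : ℕ) + (r + 1) + 1 + 1 - j = r + 3 by omega,
        show (j : ℕ) - (j + (r + 1) + 1) + (j + (r + 1) + 1 - j) = r + 2 by omega]
      simp [symmCoeff]; ring
  · rw [h]
    simp [symmCoeff, grunwaldCoeff_one]; ring
  · obtain ⟨r, hr⟩ : ∃ r, (j : ℕ) = k + r + 1 := ⟨j - k - 1, by omega⟩
    rw [hr]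
    rcases r with _ | r
    · rw [if_pos (by omega), if_pos (by omega), show (k : ℕ) + 1 - (k + 0 + 1) = 0 by omega,
        show (k : ℕ) + 0 + 1 + 1 - k = 2 by omega,
        show (k : ℕ) + 0 + 1 - k + (k - (k + 0 + 1)) = 1 by omega]
      simp [symmCoeff, grunwaldCoeff_zero]; ring
    · rw [if_pos (by omega), if_neg (by omega),
        show (k : ℕ) + (r + 1) + 1 + 1 - k = r + 3 by omega,
        show (k : ℕ) + (r + 1) + 1 - k + (k - (k + (r + 1) + 1)) = r + 2 by omega]
      simp [symmCoeff]; ring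

/-! ### Diagonal dominance and the one-dimensional Tau bounds. -/

theorem dotProduct_mulVec_eq_sum {ι : Type*} [Fintype ι] (M : Matrix ι ι ℝ) (x y : ι → ℝ) :
    x ⬝ᵥ M *ᵥ y = ∑ i, ∑ j, M i j * (x i * y j) := by
  simp only [dotProduct, Matrix.mulVec, Finset.mul_sum]
  exact Finset.sum_congr rfl fun i _ => Finset.sum_congr rfl fun j _ => by ring

/-- A quadratic form is nonnegative when its matrix is dominated, in the sense of diagonal
dominance, by a symmetric matrix with nonnegative row sums. -/
theorem quadForm_nonneg_of_rowSum_nonneg {ι : Type*} [Fintype ι] (M C : Matrix ι ι ℝ)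
    (hC : ∀ i j, C i j = C j i) (hrow : ∀ i, 0 ≤ ∑ j, C i j) (hdiag : ∀ i, C i i ≤ M i i)
    (hoff : ∀ i j, i ≠ j → |M i j| ≤ -C i j) (x : ι → ℝ) : 0 ≤ x ⬝ᵥ M *ᵥ x := by
  -- Off the diagonal this is 2|x i * x j| ≤ x i ^ 2 + x j ^ 2, weighted by |M i j| ≤ -C i j.
  -- Summing the left side over i and j leaves the row sums of C times squares.
  have key : ∀ i j, C i j * (x i ^ 2 / 2) + C i j * (x j ^ 2 / 2) ≤ M i j * (x i * x j) := by
    intro i j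
    by_cases h : i = j
    · subst h
      nlinarith [mul_nonneg (sub_nonneg.2 (hdiag i)) (sq_nonneg (x i))]
    · obtain ⟨h1, h2⟩ := abs_le.1 (hoff i j h)
      nlinarith [mul_nonneg (sub_nonneg.2 h1) (sq_nonneg (x i + x j)),
        mul_nonneg (sub_nonneg.2 h2) (sq_nonneg (x i - x j))]
  rw [dotProduct_mulVec_eq_sum]
  calc (0 : ℝ) ≤ ∑ i, (∑ j, C i j) * x i ^ 2 :=
        Finset.sum_nonneg fun i _ => mul_nonneg (hrow i) (sq_nonneg _)
    _ = ∑ i, ∑ j, (C i j * (x i ^ 2 / 2) + C i j * (x j ^ 2 / 2)) := by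
        simp only [Finset.sum_add_distrib]
        rw [Finset.sum_comm (f := fun i j => C i j * (x j ^ 2 / 2)), ← Finset.sum_add_distrib]
        refine Finset.sum_congr rfl fun i _ => ?_
        simp only [hC _ i, ← Finset.sum_mul]
        ring
    _ ≤ _ := Finset.sum_le_sum fun i _ => Finset.sum_le_sum fun j _ => key i j

/-- By injectivity each index of I is hit at most once, and the terms it misses are nonpositive. -/
theorem sum_le_sum_comp_of_injOn {S I : Finset ℕ} {u : ℕ → ℝ} {f : ℕ → ℕ}
    (hf : Set.InjOn f S) (hmap : ∀ j ∈ S, u (f j) ≠ 0 → f j ∈ I) (hu : ∀ s ∈ I, u s ≤ 0) :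
    ∑ s ∈ I, u s ≤ ∑ j ∈ S, u (f j) := by
  classical
  rw [← Finset.sum_image hf, ← Finset.sum_filter_ne_zero (S.image f)]
  have hsub : (S.image f).filter (fun s => u s ≠ 0) ⊆ I := by
    intro s hs
    obtain ⟨hs, h0⟩ := Finset.mem_filter.1 hs
    obtain ⟨j, hj, rfl⟩ := Finset.mem_image.1 hs
    exact hmap j hj h0
  rw [← Finset.sum_sdiff hsub]
  have := Finset.sum_nonpos fun s (hs : s ∈ I \ (S.image f).filter (fun s => u s ≠ 0)) =>
    hu s (Finset.mem_sdiff.1 hs).1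
  linarith

/-- The row sums of a symmetric Toeplitz matrix plus its Hankel correction are bounded below. -/
theorem rowSum_toeplitz_add_hankel {m : ℕ} {t : ℕ → ℝ} (ht : ∀ s, 1 ≤ s → t s ≤ 0)
    {i : ℕ} (hi : i < m) :
    t 0 + 2 * ∑ s ∈ Finset.Ico 1 m, t s ≤
      ∑ j ∈ Finset.range m, (t ((i - j) + (j - i)) +
        ((if i + j + 2 < m then t (i + j + 2) else 0) +
          (if 2 * m - (i + j) < m then t (2 * m - (i + j)) else 0))) := by
  -- Continuing t by zero absorbs the two conditionals of the Hankel part.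
  set u : ℕ → ℝ := fun s => if s < m then t s else 0 with hu
  have hu_eq : ∀ s, s < m → u s = t s := fun s hs => if_pos hs
  have hlt : ∀ s, u s ≠ 0 → s < m := fun s hs => by
    by_contra h; exact hs (if_neg h)
  have hu0 : ∀ s, 1 ≤ s → u s ≤ 0 := fun s hs => by
    simp only [hu]; split_ifs
    · exact ht s hs
    · exact le_rfl
  -- The four pieces of the row pair up: the Toeplitz entries left of the diagonal with one Hankel
  -- corner, those right of it with the other. Each pair uses every offset in [1, m) at most once.
  have a1 : ∑ s ∈ Finset.Ico 1 (i + 1), u s ≤ ∑ j ∈ Finset.Ico 0 i, u ((i - j) + (j - i)) := by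
    refine sum_le_sum_comp_of_injOn ?_ ?_ fun s hs => hu0 s (Finset.mem_Ico.1 hs).1
    · intro a ha b hb h; simp at ha hb h; omega
    · intro j hj _; simp at hj ⊢; omega
  have a2 : ∑ s ∈ Finset.Ico 1 (m - i), u s ≤
      ∑ j ∈ Finset.Ico (i + 1) m, u ((i - j) + (j - i)) := by
    refine sum_le_sum_comp_of_injOn ?_ ?_ fun s hs => hu0 s (Finset.mem_Ico.1 hs).1
    · intro a ha b hb h; simp at ha hb h; omega
    · intro j hj _; simp at hj ⊢; omega
  have a3 : ∑ s ∈ Finset.Ico (i + 1) m, u s ≤ ∑ j ∈ Finset.range m, u (i + j + 2) := by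
    refine sum_le_sum_comp_of_injOn ?_ ?_ fun s hs => hu0 s (by simp at hs; omega)
    · intro a ha b hb h; simp at ha hb h; omega
    · intro j hj h; have := hlt _ h; simp at hj ⊢; omega
  have a4 : ∑ s ∈ Finset.Ico (m - i) m, u s ≤ ∑ j ∈ Finset.range m, u (2 * m - (i + j)) := by
    refine sum_le_sum_comp_of_injOn ?_ ?_ fun s hs => hu0 s (by simp at hs; omega)
    · intro a ha b hb h; simp at ha hb h; omega
    · intro j hj h; have := hlt _ h; simp at hj ⊢; omega
  have e1 := Finset.sum_Ico_consecutive u (show 1 ≤ i + 1 by omega) (show i + 1 ≤ m by omega)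
  have e2 := Finset.sum_Ico_consecutive u (show 1 ≤ m - i by omega) (show m - i ≤ m by omega)
  have e3 : ∑ j ∈ Finset.range m, t ((i - j) + (j - i)) =
      ∑ j ∈ Finset.Ico 0 m, u ((i - j) + (j - i)) := by
    rw [Finset.range_eq_Ico]
    refine Finset.sum_congr rfl fun j hj => (hu_eq _ ?_).symm
    simp at hj; omega
  have e4 := Finset.sum_Ico_consecutive (fun j => u ((i - j) + (j - i))) (Nat.zero_le i) hi.le
  have e5 := Finset.sum_eq_sum_Ico_succ_bot hi (fun j => u ((i - j) + (j - i)))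
  have e6 : ∑ s ∈ Finset.Ico 1 m, t s = ∑ s ∈ Finset.Ico 1 m, u s :=
    Finset.sum_congr rfl fun s hs => (hu_eq _ (by simp at hs; omega)).symm
  have e7 : u (i - i + (i - i)) = t 0 := by simp only [Nat.sub_self]; exact hu_eq 0 (by omega)
  rw [Finset.sum_add_distrib, Finset.sum_add_distrib, e3, e6]
  change _ ≤ _ + (∑ j ∈ Finset.range m, u (i + j + 2) +
    ∑ j ∈ Finset.range m, u (2 * m - (i + j)))
  linarith

theorem firstColumn_eq {m : ℕ} {T : Matrix (Fin m) (Fin m) ℝ} {t : ℕ → ℝ}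
    (hT : ∀ j k, T j k = t (((j : ℕ) - k) + ((k : ℕ) - j))) (s : ℕ) :
    firstColumn T s = if s < m then t s else 0 := by
  unfold firstColumn
  split_ifs
  · rw [hT]; simp
  · rfl

theorem tau_quadForm_bounds {m : ℕ} {T : Matrix (Fin m) (Fin m) ℝ} {t : ℕ → ℝ}
    (hT : ∀ j k, T j k = t (((j : ℕ) - k) + ((k : ℕ) - j)))
    (hneg : ∀ s, 1 ≤ s → t s ≤ 0) (hmono : ∀ s r, 1 ≤ s → s ≤ r → t s ≤ t r)
    (hsum : 0 ≤ t 0 + 2 * ∑ s ∈ Finset.Ico 1 m, t s) (x : Fin m → ℝ) :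
    1 / 2 * (x ⬝ᵥ tau T *ᵥ x) ≤ x ⬝ᵥ T *ᵥ x ∧ x ⬝ᵥ T *ᵥ x ≤ 3 / 2 * (x ⬝ᵥ tau T *ᵥ x) := by
  have hH : ∀ j k : Fin m, tauHankel T j k =
      (if (j : ℕ) + k + 2 < m then t ((j : ℕ) + k + 2) else 0) +
        (if 2 * m - ((j : ℕ) + k) < m then t (2 * m - ((j : ℕ) + k)) else 0) := fun j k => by
    simp only [tauHankel, Matrix.of_apply, firstColumn_eq hT]
  have hH0 : ∀ j k, tauHankel T j k ≤ 0 := fun j k => by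
    rw [hH]
    refine add_nonpos ?_ ?_ <;> split_ifs <;> first | exact le_rfl | exact hneg _ (by omega)
  -- At most one Hankel corner is nonzero at a given entry, and its offset exceeds |j - k|, so
  -- monotonicity of t applies.
  have hTH : ∀ j k, j ≠ k → T j k ≤ tauHankel T j k := fun j k hjk => by
    have hjk' : (j : ℕ) ≠ k := fun h => hjk (Fin.ext h)
    have := j.2
    have := k.2
    have h0 : T j k ≤ 0 := by rw [hT]; exact hneg _ (by omega)
    rw [hH]
    split_ifs
    · omega
    · rw [add_zero, hT]; exact hmono _ _ (by omega) (by omega)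
    · rw [zero_add, hT]; exact hmono _ _ (by omega) (by omega)
    · rwa [add_zero]
  -- With H = `tauHankel T`, T - τ(T)/2 = (T + H)/2 and 3τ(T)/2 - T = (T - 3H)/2. Since T ≤ H ≤ 0
  -- off the diagonal and H ≤ 0 on it, C dominates both.
  set C : Matrix (Fin m) (Fin m) ℝ := (1 / 2 : ℝ) • (T + tauHankel T) with hC
  have hCsymm : ∀ i j, C i j = C j i := fun i j => by
    simp only [hC, Matrix.smul_apply, Matrix.add_apply, hT, hH, add_comm (j : ℕ) (i : ℕ),
      add_comm ((j : ℕ) - i)]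
  have hCrow : ∀ i, 0 ≤ ∑ j, C i j := fun i => by
    have h := rowSum_toeplitz_add_hankel hneg i.2
    rw [Finset.sum_range] at h
    simp only [hC, Matrix.smul_apply, Matrix.add_apply, smul_eq_mul, hT, hH, ← Finset.mul_sum]
    linarith
  have p1 := quadForm_nonneg_of_rowSum_nonneg (T - (1 / 2 : ℝ) • tau T) C hCsymm hCrow
    (fun i => by simp [hC, tau]; linarith)
    (fun i j hij => by
      have := hTH i j hij
      have := hH0 i j
      rw [abs_le]
      simp only [hC, tau, Matrix.smul_apply, Matrix.add_apply, Matrix.sub_apply, smul_eq_mul]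
      constructor <;> linarith) x
  have p2 := quadForm_nonneg_of_rowSum_nonneg ((3 / 2 : ℝ) • tau T - T) C hCsymm hCrow
    (fun i => by have := hH0 i i; simp [hC, tau]; linarith)
    (fun i j hij => by
      have := hTH i j hij
      have := hH0 i j
      rw [abs_le]
      simp only [hC, tau, Matrix.smul_apply, Matrix.add_apply, Matrix.sub_apply, smul_eq_mul]
      constructor <;> linarith) x
  rw [Matrix.sub_mulVec, Matrix.smul_mulVec, dotProduct_sub, dotProduct_smul, smul_eq_mul] at p1 p2
  constructor <;> linarith

theorem tau_grunwaldMatrix_bounds {α : ℝ} (h1 : 1 < α) (h2 : α < 2) {m : ℕ} (x : Fin m → ℝ) :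
    1 / 2 * (x ⬝ᵥ tau (symmPart (grunwaldMatrix α m)) *ᵥ x) ≤ x ⬝ᵥ grunwaldMatrix α m *ᵥ x ∧
      x ⬝ᵥ grunwaldMatrix α m *ᵥ x ≤
        3 / 2 * (x ⬝ᵥ tau (symmPart (grunwaldMatrix α m)) *ᵥ x) := by
  have h := tau_quadForm_bounds (fun j k => symmPart_grunwaldMatrix_apply α (m := m) j k)
    (fun s => symmCoeff_nonpos h1 h2) (fun s r => symmCoeff_mono h1 h2)
    (sum_symmCoeff_nonneg h1 h2 m) x
  have e : x ⬝ᵥ symmPart (grunwaldMatrix α m) *ᵥ x = x ⬝ᵥ grunwaldMatrix α m *ᵥ x := by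
    rw [symmPart, Matrix.smul_mulVec, Matrix.add_mulVec, dotProduct_smul, dotProduct_add,
      Matrix.mulVec_transpose, dotProduct_comm x (x ᵥ* _), ← Matrix.dotProduct_mulVec, smul_eq_mul]
    ring
  rwa [e] at h

theorem tau_grunwaldMatrix_symm (α : ℝ) {m : ℕ} (j k : Fin m) :
    tau (symmPart (grunwaldMatrix α m)) j k = tau (symmPart (grunwaldMatrix α m)) k j := by
  simp only [tau, tauHankel, Matrix.sub_apply, Matrix.of_apply, symmPart_grunwaldMatrix_apply,
    add_comm (j : ℕ) (k : ℕ), add_comm ((j : ℕ) - k)]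

/-- Reversal exchanges the two corners of the Hankel part and preserves |j - k|. -/
theorem tau_grunwaldMatrix_rev (α : ℝ) {m : ℕ} (j k : Fin m) :
    tau (symmPart (grunwaldMatrix α m)) j.rev k.rev =
      tau (symmPart (grunwaldMatrix α m)) j k := by
  have := j.2
  have := k.2
  simp only [tau, tauHankel, Matrix.sub_apply, Matrix.of_apply, symmPart_grunwaldMatrix_apply,
    Fin.val_rev]
  rw [show m - ((j : ℕ) + 1) + (m - (k + 1)) + 2 = 2 * m - (j + k) by omega,
    show 2 * m - (m - ((j : ℕ) + 1) + (m - (k + 1))) = j + k + 2 by omega,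
    show m - ((j : ℕ) + 1) - (m - (k + 1)) + (m - (k + 1) - (m - (j + 1))) =
      j - k + (k - j) by omega]
  ring

theorem grunwaldMatrix_rev (α : ℝ) {m : ℕ} (j k : Fin m) :
    grunwaldMatrix α m j.rev k.rev = grunwaldMatrix α m k j := by
  have := j.2
  have := k.2
  simp only [grunwaldMatrix, Matrix.of_apply, Fin.val_rev]
  split_ifs <;> first | rfl | omega | (congr 2; omega)

/-! ### The symbol and the sector containing the numerical range. -/

theorem grunwaldCoeff_eq_choose (α : ℝ) (k : ℕ) :
    grunwaldCoeff α k = (-1) ^ k * Ring.choose α k := by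
  have h : ((descPochhammer ℤ k).smeval α : ℝ) = ∏ j ∈ Finset.range k, (α - (j : ℝ)) := by
    induction k with
    | zero => simp
    | succ k ih =>
      rw [descPochhammer_succ_right, Polynomial.smeval_mul, ih, Finset.prod_range_succ]
      simp [Polynomial.smeval_natCast]
  rw [Ring.choose_eq_smul, h, grunwaldCoeff, smul_eq_mul]
  ring

theorem hasSum_grunwaldCoeff (α : ℝ) {z : ℂ} (hz : ‖z‖ < 1) :
    HasSum (fun k : ℕ => (grunwaldCoeff α k : ℂ) * z ^ k) ((1 - z) ^ (α : ℂ)) := by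
  have h := (Complex.one_add_cpow_hasFPowerSeriesOnBall_zero (a := (α : ℂ))).hasSum (y := -z)
    (by
      rw [Metric.mem_eball, edist_zero_right, enorm_neg, ← ofReal_norm]
      exact ENNReal.ofReal_lt_one.2 hz)
  rw [zero_add, ← sub_eq_add_neg] at h
  have e : (fun k : ℕ => (grunwaldCoeff α k : ℂ) * z ^ k) =
      fun k => binomialSeries ℂ (α : ℂ) k fun _ => -z := funext fun k => by
    rw [binomialSeries_apply, grunwaldCoeff_eq_choose, ← Complex.ofReal_choose]
    simp only [List.ofFn_const, List.prod_replicate, smul_eq_mul]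
    rw [neg_pow z]
    push_cast
    ring
  rw [e]
  exact h

theorem summable_abs_grunwaldCoeff {α : ℝ} (h1 : 1 < α) (h2 : α < 2) :
    Summable fun k => |grunwaldCoeff α k| := by
  rw [← summable_nat_add_iff 2]
  -- The first two coefficients add up to 1 - α, and the full partial sums are nonpositive.
  refine summable_of_sum_range_le (c := α - 1) (fun _ => abs_nonneg _) fun n => ?_
  have h := sum_grunwaldCoeff_nonpos h1 h2 (N := n + 2) (by omega)
  rw [Finset.sum_range_succ', Finset.sum_range_succ', grunwaldCoeff_zero, zero_add,
    grunwaldCoeff_one] at h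
  have e : ∑ i ∈ Finset.range n, |grunwaldCoeff α (i + 2)| =
      ∑ i ∈ Finset.range n, grunwaldCoeff α (i + 1 + 1) :=
    Finset.sum_congr rfl fun i _ => abs_of_pos (grunwaldCoeff_pos h1 h2 (by omega))
  rw [e]
  linarith

/-- The binomial series on the unit circle. -/
theorem tsum_grunwaldCoeff_circle {α : ℝ} (h1 : 1 < α) (h2 : α < 2) {z : ℂ} (hz : ‖z‖ = 1)
    (hz1 : 0 < (1 - z).re) :
    ∑' k : ℕ, (grunwaldCoeff α k : ℂ) * z ^ k = (1 - z) ^ (α : ℂ) := by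
  have hs : Summable fun k : ℕ => (grunwaldCoeff α k : ℂ) * z ^ k := by
    refine Summable.of_norm ?_
    simpa [hz] using summable_abs_grunwaldCoeff h1 h2
  -- Abel's theorem: the sum on the circle is the radial limit of the sums inside the disc. The
  -- power is continuous there because 1 - z lies in the right half-plane, off the branch cut.
  have t1 := Complex.tendsto_tsum_powerSeries_nhdsWithin_lt hs.hasSum.tendsto_sum_nat
  rw [Filter.tendsto_map'_iff] at t1
  have t2 : Filter.Tendsto (fun r : ℝ => (1 - z * (r : ℂ)) ^ (α : ℂ)) (nhdsWithin 1 (Set.Iio 1))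
      (nhds ((1 - z) ^ (α : ℂ))) := by
    have hc : ContinuousAt (fun r : ℝ => (1 - z * (r : ℂ)) ^ (α : ℂ)) 1 := by
      refine ContinuousAt.cpow (by fun_prop) continuousAt_const ?_
      left
      simpa using hz1
    have := hc.tendsto
    simp only [Complex.ofReal_one, mul_one] at this
    exact this.mono_left nhdsWithin_le_nhds
  refine tendsto_nhds_unique t1 (t2.congr' ?_)
  have hmem : Set.Ioo (0 : ℝ) 1 ∈ nhdsWithin (1 : ℝ) (Set.Iio 1) := Ioo_mem_nhdsLT (by norm_num)
  filter_upwards [hmem] with r hr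
  have hn : ‖z * (r : ℂ)‖ < 1 := by
    rw [norm_mul, hz, one_mul, Complex.norm_real, Real.norm_of_nonneg hr.1.le]
    exact hr.2
  rw [← (hasSum_grunwaldCoeff α hn).tsum_eq]
  simp [mul_pow, mul_assoc]

/-- The generating function of the shifted Grünwald matrices. -/
def symbol (α θ : ℝ) : ℂ :=
  -∑' l : ℕ, (grunwaldCoeff α l : ℂ) * Complex.exp ((((l : ℝ) - 1) * θ : ℝ) * Complex.I)

theorem one_sub_exp_eq {θ : ℝ} (h0 : 0 < θ) (h1 : θ < 2 * Real.pi) :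
    1 - Complex.exp (θ * Complex.I) =
      Complex.exp ((Real.log (2 * Real.sin (θ / 2)) : ℝ) + ((θ - Real.pi) / 2 : ℝ) * Complex.I) := by
  have hs : 0 < Real.sin (θ / 2) := Real.sin_pos_of_pos_of_lt_pi (by linarith) (by linarith)
  rw [Complex.exp_add, ← Complex.ofReal_exp, Real.exp_log (by positivity), Complex.exp_mul_I,
    Complex.exp_mul_I, ← Complex.ofReal_cos, ← Complex.ofReal_sin, ← Complex.ofReal_cos,
    ← Complex.ofReal_sin, show (θ - Real.pi) / 2 = θ / 2 - Real.pi / 2 by ring,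
    Real.cos_sub_pi_div_two, Real.sin_sub_pi_div_two]
  have c2 : Real.cos θ = 1 - 2 * Real.sin (θ / 2) ^ 2 := by
    have := Real.cos_two_mul (θ / 2)
    have := Real.sin_sq_add_cos_sq (θ / 2)
    rw [show 2 * (θ / 2) = θ by ring] at *
    linarith
  have s2 : Real.sin θ = 2 * Real.sin (θ / 2) * Real.cos (θ / 2) := by
    rw [← Real.sin_two_mul]; ring_nf
  rw [c2, s2]
  push_cast
  ring

theorem symbol_eq {α : ℝ} (h1 : 1 < α) (h2 : α < 2) {θ : ℝ} (h0 : 0 < θ)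
    (hθ : θ < 2 * Real.pi) :
    symbol α θ = ((2 * Real.sin (θ / 2)) ^ α : ℝ) *
      Complex.exp (((Real.pi - θ) * (1 - α / 2) : ℝ) * Complex.I) := by
  have hs : 0 < Real.sin (θ / 2) := Real.sin_pos_of_pos_of_lt_pi (by linarith) (by linarith)
  have hre : 0 < (1 - Complex.exp (θ * Complex.I)).re := by
    rw [Complex.sub_re, Complex.exp_ofReal_mul_I_re, Complex.one_re,
      show θ = 2 * (θ / 2) by ring, Real.cos_two_mul]
    nlinarith [Real.sin_sq_add_cos_sq (θ / 2)]
  have key := tsum_grunwaldCoeff_circle h1 h2 (Complex.norm_exp_ofReal_mul_I θ) hre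
  have e : ∀ l : ℕ, (grunwaldCoeff α l : ℂ) *
      Complex.exp ((((l : ℝ) - 1) * θ : ℝ) * Complex.I) =
      Complex.exp (-θ * Complex.I) *
        ((grunwaldCoeff α l : ℂ) * Complex.exp (θ * Complex.I) ^ l) := fun l => by
    rw [← Complex.exp_nat_mul, mul_left_comm, ← Complex.exp_add]
    congr 2
    push_cast
    ring
  -- Writing the sign as e^{iπ} gives the total phase π - θ + α(θ - π)/2 = (π - θ)(1 - α/2). The
  -- logarithm is principal because |(θ - π)/2| < π.
  rw [symbol, tsum_congr e, tsum_mul_left, key, one_sub_exp_eq h0 hθ,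
    Complex.cpow_def_of_ne_zero (Complex.exp_ne_zero _), Complex.log_exp (by simp; linarith)
      (by simp; linarith), Real.rpow_def_of_pos (by positivity), Complex.ofReal_exp,
    ← Complex.exp_add, ← Complex.exp_add, ← neg_one_mul, ← Complex.exp_pi_mul_I,
    ← Complex.exp_add]
  congr 1
  push_cast
  ring

theorem symbol_sector {α : ℝ} (h1 : 1 < α) (h2 : α < 2) {θ : ℝ} (h0 : 0 < θ)
    (hθ : θ < 2 * Real.pi) :
    |(symbol α θ).im| ≤ |Real.tan (α / 2 * Real.pi)| * (symbol α θ).re := by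
  have hs : 0 < Real.sin (θ / 2) := Real.sin_pos_of_pos_of_lt_pi (by linarith) (by linarith)
  have hpi := Real.pi_pos
  rw [symbol_eq h1 h2 h0 hθ, Complex.re_ofReal_mul, Complex.im_ofReal_mul,
    Complex.exp_ofReal_mul_I_re, Complex.exp_ofReal_mul_I_im, abs_mul,
    abs_of_nonneg (Real.rpow_nonneg (by positivity) _), mul_left_comm]
  refine mul_le_mul_of_nonneg_left ?_ (Real.rpow_nonneg (by positivity) _)
  set φ := (Real.pi - θ) * (1 - α / 2) with hφ
  set φ₀ := Real.pi * (1 - α / 2) with hφ₀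
  have ha : 0 < 1 - α / 2 := by linarith
  have hle : |φ| ≤ φ₀ := by
    rw [hφ, abs_mul, abs_of_pos ha]
    exact mul_le_mul_of_nonneg_right (abs_le.2 ⟨by linarith, by linarith⟩) ha.le
  have hφ₀pos : 0 < φ₀ := by positivity
  have hφ₀lt : φ₀ < Real.pi / 2 := by nlinarith
  have htan : |Real.tan (α / 2 * Real.pi)| = Real.tan φ₀ := by
    rw [show α / 2 * Real.pi = Real.pi - φ₀ by rw [hφ₀]; ring, Real.tan_pi_sub, abs_neg,
      abs_of_pos (Real.tan_pos_of_pos_of_lt_pi_div_two hφ₀pos hφ₀lt)]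
  have hcos : 0 < Real.cos φ₀ := Real.cos_pos_of_mem_Ioo ⟨by linarith, hφ₀lt⟩
  have habs : |Real.sin φ| = Real.sin |φ| := by
    refine (Real.abs_sin_eq_sin_abs_of_abs_le_pi (by linarith))
  rw [htan, Real.tan_eq_sin_div_cos, div_mul_eq_mul_div, le_div_iff₀ hcos, habs,
    ← Real.cos_abs φ]
  -- Cleared of denominators, the claim is sin(φ₀ - |φ|) ≥ 0.
  have := Real.sin_nonneg_of_nonneg_of_le_pi (x := φ₀ - |φ|) (by linarith)
    (by linarith [abs_nonneg φ])
  rw [Real.sin_sub] at this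
  linarith

theorem continuous_symbol {α : ℝ} (h1 : 1 < α) (h2 : α < 2) : Continuous (symbol α) := by
  refine Continuous.neg (continuous_tsum (fun l => by fun_prop)
    (summable_abs_grunwaldCoeff h1 h2) fun l θ => ?_)
  rw [norm_mul, Complex.norm_exp_ofReal_mul_I, mul_one, Complex.norm_real, Real.norm_eq_abs]

theorem symbol_sector_Icc {α : ℝ} (h1 : 1 < α) (h2 : α < 2) {θ : ℝ}
    (hθ : θ ∈ Set.Icc 0 (2 * Real.pi)) :
    |(symbol α θ).im| ≤ |Real.tan (α / 2 * Real.pi)| * (symbol α θ).re := by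
  have hc := continuous_symbol h1 h2
  rw [← closure_Ioo (by positivity)] at hθ
  exact closure_minimal (fun θ hθ => symbol_sector h1 h2 hθ.1 hθ.2)
    (isClosed_le (f := fun θ => |(symbol α θ).im|)
      (g := fun θ => |Real.tan (α / 2 * Real.pi)| * (symbol α θ).re)
      (continuous_abs.comp (Complex.continuous_im.comp hc))
      (continuous_const.mul (Complex.continuous_re.comp hc))) hθ

theorem integral_exp_int (n : ℤ) :
    ∫ θ in (0 : ℝ)..2 * Real.pi, Complex.exp (((n : ℝ) * θ : ℝ) * Complex.I) =
      if n = 0 then 2 * (Real.pi : ℂ) else 0 := by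
  split_ifs with h
  · simp [h]
  · have hc : (n : ℂ) * Complex.I ≠ 0 := by simp [h]
    have e : ∀ θ : ℝ, Complex.exp (((n : ℝ) * θ : ℝ) * Complex.I) =
        Complex.exp ((n : ℂ) * Complex.I * θ) := fun θ => by
      congr 1; push_cast; ring
    simp only [e]
    rw [integral_exp_mul_complex hc]
    have : Complex.exp ((n : ℂ) * Complex.I * ((2 * Real.pi : ℝ) : ℂ)) = 1 := by
      rw [Complex.exp_eq_one_iff]
      exact ⟨n, by push_cast; ring⟩
    rw [this]
    simp

/-- The entries of the shifted Grünwald matrix are Fourier coefficients of the symbol. -/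
theorem integral_symbol {α : ℝ} (h1 : 1 < α) (h2 : α < 2) {m : ℕ} (j k : Fin m) :
    ∫ θ in (0 : ℝ)..2 * Real.pi,
      symbol α θ * Complex.exp (((((k : ℤ) - (j : ℤ) : ℤ) : ℝ) * θ : ℝ) * Complex.I) =
      2 * Real.pi * (grunwaldMatrix α m j k : ℂ) := by
  set F : ℕ → ℝ → ℂ := fun l θ => -(grunwaldCoeff α l : ℂ) *
    Complex.exp ((((((l : ℤ) - 1 + k - j : ℤ)) : ℝ) * θ : ℝ) * Complex.I) with hF
  have hFn : ∀ l θ, ‖F l θ‖ = |grunwaldCoeff α l| := fun l θ => by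
    rw [hF]
    simp only
    rw [norm_mul, Complex.norm_exp_ofReal_mul_I, mul_one, norm_neg, Complex.norm_real, Real.norm_eq_abs]
  have hsum := summable_abs_grunwaldCoeff h1 h2
  have hFsum : ∀ θ : ℝ, HasSum (fun l => F l θ)
      (symbol α θ * Complex.exp (((((k : ℤ) - (j : ℤ) : ℤ) : ℝ) * θ : ℝ) * Complex.I)) := by
    intro θ
    have hs : Summable fun l => F l θ := Summable.of_norm (by simpa only [hFn] using hsum)
    have e : ∑' l, F l θ =
        symbol α θ * Complex.exp (((((k : ℤ) - (j : ℤ) : ℤ) : ℝ) * θ : ℝ) * Complex.I) := by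
      rw [symbol, ← tsum_neg, ← tsum_mul_right]
      refine tsum_congr fun l => ?_
      rw [hF]
      simp only
      rw [← neg_mul, mul_assoc, ← Complex.exp_add]
      congr 2
      push_cast
      ring
    rw [← e]
    exact hs.hasSum
  have hint := intervalIntegral.hasSum_integral_of_dominated_convergence (μ := MeasureTheory.volume)
    (a := 0) (b := 2 * Real.pi) (F := F) (fun l _ => |grunwaldCoeff α l|)
    (fun l => Continuous.aestronglyMeasurable (by fun_prop))
    (fun l => Filter.Eventually.of_forall fun θ _ => (hFn l θ).le)
    (Filter.Eventually.of_forall fun _ _ => hsum)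
    (intervalIntegrable_const)
    (Filter.Eventually.of_forall fun θ _ => hFsum θ)
  rw [← hint.tsum_eq]
  have hFi : ∀ l, ∫ θ in (0 : ℝ)..2 * Real.pi, F l θ =
      if (l : ℤ) - 1 + k - j = 0 then -(grunwaldCoeff α l : ℂ) * (2 * Real.pi) else 0 := fun l => by
    rw [hF, intervalIntegral.integral_const_mul, integral_exp_int]
    split_ifs <;> simp
  simp only [hFi]
  by_cases hkj : (k : ℕ) ≤ (j : ℕ) + 1
  · rw [tsum_eq_single ((j : ℕ) + 1 - k) fun l hl => if_neg (by omega), if_pos (by omega)]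
    simp only [grunwaldMatrix, Matrix.of_apply, if_pos hkj]
    push_cast
    ring
  · rw [tsum_congr (g := fun _ => 0) fun l => if_neg (by omega)]
    simp [grunwaldMatrix, hkj]

/-- The numerical range of the shifted Grünwald matrix lies in the sector of its symbol. -/
theorem grunwaldMatrix_sector {α : ℝ} (h1 : 1 < α) (h2 : α < 2) {m : ℕ} (x y : Fin m → ℝ) :
    |x ⬝ᵥ (grunwaldMatrix α m - (grunwaldMatrix α m)ᵀ) *ᵥ y| ≤
      |Real.tan (α / 2 * Real.pi)| *
        (x ⬝ᵥ grunwaldMatrix α m *ᵥ x + y ⬝ᵥ grunwaldMatrix α m *ᵥ y) := by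
  set L := grunwaldMatrix α m with hL
  set t := |Real.tan (α / 2 * Real.pi)| with ht
  -- For z = x + iy the form z*Lz has real part x·Lx + y·Ly and imaginary part x·(L - Lᵀ)y. It is
  -- also the mean over [0, 2π] of the symbol against |w|², so it inherits the sector, a convex
  -- cone.
  set z : Fin m → ℂ := fun j => ⟨x j, y j⟩ with hz
  set w : ℝ → ℂ := fun θ => ∑ k : Fin m, z k * Complex.exp ((((k : ℕ) : ℝ) * θ : ℝ) * Complex.I)
    with hw
  have hwc : Continuous w := by fun_prop
  have hsc := continuous_symbol h1 h2
  have hconj : ∀ r : ℝ, (starRingEnd ℂ) (Complex.exp ((r : ℂ) * Complex.I)) =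
      Complex.exp (((-r : ℝ) : ℂ) * Complex.I) := fun r => by
    rw [← Complex.exp_conj]; simp
  have hnorm : ∀ θ, ((‖w θ‖ ^ 2 : ℝ) : ℂ) = ∑ j, ∑ k, (starRingEnd ℂ) (z j) * z k *
      Complex.exp (((((k : ℤ) - (j : ℤ) : ℤ) : ℝ) * θ : ℝ) * Complex.I) := fun θ => by
    rw [Complex.ofReal_pow, ← Complex.conj_mul', hw]
    simp only
    rw [map_sum, Finset.sum_mul_sum]
    refine Finset.sum_congr rfl fun j _ => Finset.sum_congr rfl fun k _ => ?_
    rw [map_mul, hconj, mul_mul_mul_comm, ← Complex.exp_add]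
    congr 2
    push_cast
    ring
  set Q : ℂ := ∑ j, ∑ k, (starRingEnd ℂ) (z j) * z k * (L j k : ℂ) with hQ
  have hint : ∫ θ in (0 : ℝ)..2 * Real.pi, symbol α θ * ((‖w θ‖ ^ 2 : ℝ) : ℂ) =
      2 * Real.pi * Q := by
    simp only [hnorm, Finset.mul_sum, hQ]
    rw [intervalIntegral.integral_finsetSum fun j _ => Continuous.intervalIntegrable
      (by fun_prop) _ _]
    refine Finset.sum_congr rfl fun j _ => ?_
    rw [intervalIntegral.integral_finsetSum fun j _ => Continuous.intervalIntegrable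
      (by fun_prop) _ _]
    refine Finset.sum_congr rfl fun k _ => ?_
    simp only [mul_left_comm (symbol α _)]
    rw [intervalIntegral.integral_const_mul, integral_symbol h1 h2]
    ring
  -- The two signs of s give the two half-planes whose intersection is the sector; t Re f - s Im f
  -- is the real part of (t + is)f.
  have hpos : ∀ s : ℝ, |s| = 1 → 0 ≤ t * Q.re - s * Q.im := fun s hs => by
    have h3 : 0 ≤ ∫ θ in (0 : ℝ)..2 * Real.pi,
        Complex.reCLM (((t : ℂ) + s * Complex.I) * (symbol α θ * ((‖w θ‖ ^ 2 : ℝ) : ℂ))) := by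
      refine intervalIntegral.integral_nonneg (by positivity) fun θ hθ => ?_
      have h4 := symbol_sector_Icc h1 h2 hθ
      have h5 : s * (symbol α θ).im ≤ |(symbol α θ).im| := by
        refine (le_abs_self _).trans ?_
        rw [abs_mul, hs, one_mul]
      rw [← mul_assoc, Complex.reCLM_apply, Complex.re_mul_ofReal]
      refine mul_nonneg ?_ (by positivity)
      simp
      linarith
    rw [ContinuousLinearMap.intervalIntegral_comp_comm _ (Continuous.intervalIntegrable
      (by fun_prop) _ _), intervalIntegral.integral_const_mul, hint] at h3
    have h6 : Complex.reCLM (((t : ℂ) + s * Complex.I) * (2 * Real.pi * Q)) =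
        2 * Real.pi * (t * Q.re - s * Q.im) := by
      rw [Complex.reCLM_apply, show ((t : ℂ) + s * Complex.I) * (2 * Real.pi * Q) =
        ((2 * Real.pi : ℝ) : ℂ) * (((t : ℂ) + s * Complex.I) * Q) by push_cast; ring,
        Complex.re_ofReal_mul]
      simp
    rw [h6] at h3
    exact nonneg_of_mul_nonneg_right h3 (by positivity)
  have hQre : Q.re = x ⬝ᵥ L *ᵥ x + y ⬝ᵥ L *ᵥ y := by
    rw [dotProduct_mulVec_eq_sum, dotProduct_mulVec_eq_sum, hQ, ← Finset.sum_add_distrib,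
      Complex.re_sum]
    refine Finset.sum_congr rfl fun j _ => ?_
    rw [← Finset.sum_add_distrib, Complex.re_sum]
    refine Finset.sum_congr rfl fun k _ => ?_
    simp [hz]
    ring
  have hQim : Q.im = x ⬝ᵥ (L - Lᵀ) *ᵥ y := by
    rw [Matrix.sub_mulVec, dotProduct_sub, Matrix.mulVec_transpose, dotProduct_comm x (y ᵥ* L),
      ← Matrix.dotProduct_mulVec, dotProduct_mulVec_eq_sum, dotProduct_mulVec_eq_sum, hQ,
      ← Finset.sum_sub_distrib, Complex.im_sum]
    refine Finset.sum_congr rfl fun j _ => ?_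
    rw [← Finset.sum_sub_distrib, Complex.im_sum]
    refine Finset.sum_congr rfl fun k _ => ?_
    simp [hz]
    ring
  have p1 := hpos 1 (by simp)
  have p2 := hpos (-1) (by simp)
  rw [← hQre, ← hQim, abs_le]
  constructor <;> linarith

/-! ### Bilinear estimates and eigenvalues of symmetric pencils. -/

section Abstract

variable {ι : Type*} [Fintype ι]

theorem quadForm_add_smul {M : Matrix ι ι ℝ} (hM : Mᵀ = M) (x y : ι → ℝ) (c : ℝ) :
    (x + c • y) ⬝ᵥ M *ᵥ (x + c • y) =
      x ⬝ᵥ M *ᵥ x + 2 * c * (x ⬝ᵥ M *ᵥ y) + c ^ 2 * (y ⬝ᵥ M *ᵥ y) := by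
  have h : y ⬝ᵥ M *ᵥ x = x ⬝ᵥ M *ᵥ y := by
    rw [Matrix.dotProduct_mulVec, ← Matrix.mulVec_transpose, hM, dotProduct_comm]
  simp only [Matrix.mulVec_add, Matrix.mulVec_smul, dotProduct_add, add_dotProduct,
    dotProduct_smul, smul_dotProduct, smul_eq_mul, h]
  ring

theorem sq_bilin_le {M : Matrix ι ι ℝ} (hM : Mᵀ = M) (hpos : ∀ x, 0 ≤ x ⬝ᵥ M *ᵥ x)
    (x y : ι → ℝ) : (x ⬝ᵥ M *ᵥ y) ^ 2 ≤ (x ⬝ᵥ M *ᵥ x) * (y ⬝ᵥ M *ᵥ y) := by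
  have h : ∀ c : ℝ, 0 ≤ (y ⬝ᵥ M *ᵥ y) * (c * c) + 2 * (x ⬝ᵥ M *ᵥ y) * c + x ⬝ᵥ M *ᵥ x :=
    fun c => by
      have := hpos (x + c • y)
      rw [quadForm_add_smul hM] at this
      linarith
  have := discrim_le_zero h
  rw [discrim] at this
  linarith

theorem bilin_transpose (M : Matrix ι ι ℝ) (x y : ι → ℝ) :
    x ⬝ᵥ Mᵀ *ᵥ y = y ⬝ᵥ M *ᵥ x := by
  rw [Matrix.mulVec_transpose, dotProduct_comm, Matrix.dotProduct_mulVec]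

variable [DecidableEq ι]

theorem isUnit_det_of_quadForm_pos {M : Matrix ι ι ℝ} (hpos : ∀ x, x ≠ 0 → 0 < x ⬝ᵥ M *ᵥ x) :
    IsUnit M.det := by
  rw [isUnit_iff_ne_zero]
  intro h
  obtain ⟨v, hv, hv0⟩ := Matrix.exists_mulVec_eq_zero_iff.2 h
  have := hpos v hv
  rw [hv0] at this
  simp at this

/-- If the skew part of `A` is bounded by `μ` relative to its (positive definite) symmetric part,
then `A` is bounded by `√(1 + μ²)` relative to its symmetric part. -/
theorem sq_bilin_le_of_sector {A : Matrix ι ι ℝ} {μ : ℝ} (hμ : 0 ≤ μ)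
    (hpos : ∀ x, x ≠ 0 → 0 < x ⬝ᵥ A *ᵥ x)
    (hsec : ∀ x y, |x ⬝ᵥ (A - Aᵀ) *ᵥ y| ≤ μ * (x ⬝ᵥ A *ᵥ x + y ⬝ᵥ A *ᵥ y)) (u x : ι → ℝ) :
    (u ⬝ᵥ A *ᵥ x) ^ 2 ≤ (1 + μ ^ 2) * ((u ⬝ᵥ A *ᵥ u) * (x ⬝ᵥ A *ᵥ x)) := by
  set H : Matrix ι ι ℝ := symmPart A with hH
  set S : Matrix ι ι ℝ := (1 / 2 : ℝ) • (A - Aᵀ) with hS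
  have hHA : ∀ z, z ⬝ᵥ H *ᵥ z = z ⬝ᵥ A *ᵥ z := fun z => by
    rw [hH, symmPart, Matrix.smul_mulVec, Matrix.add_mulVec, dotProduct_smul, dotProduct_add,
      bilin_transpose, smul_eq_mul]
    ring
  have hHt : Hᵀ = H := by
    rw [hH, symmPart, Matrix.transpose_smul, Matrix.transpose_add, Matrix.transpose_transpose,
      add_comm]
  have hAHS : A = H + S := by
    rw [hH, hS, symmPart, ← smul_add]
    ext i j
    simp
    ring
  have hSx : ∀ z, z ⬝ᵥ S *ᵥ z = 0 := fun z => by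
    rw [hS, Matrix.smul_mulVec, Matrix.sub_mulVec, dotProduct_smul, dotProduct_sub,
      bilin_transpose, sub_self, smul_zero]
  have hHpos : ∀ z, z ≠ 0 → 0 < z ⬝ᵥ H *ᵥ z := fun z hz => by rw [hHA]; exact hpos z hz
  have hHnn : ∀ z, 0 ≤ z ⬝ᵥ H *ᵥ z := fun z => by
    by_cases hz : z = 0
    · simp [hz]
    · exact (hHpos z hz).le
  have hunit := isUnit_det_of_quadForm_pos hHpos
  -- This choice gives Ax = H(x + k), so Cauchy–Schwarz for H becomes available.
  set k : ι → ℝ := H⁻¹ *ᵥ (S *ᵥ x) with hk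
  have hHk : H *ᵥ k = S *ᵥ x := by
    rw [hk, Matrix.mulVec_mulVec, Matrix.mul_nonsing_inv _ hunit, Matrix.one_mulVec]
  have hkk : k ⬝ᵥ H *ᵥ k ≤ μ ^ 2 * (x ⬝ᵥ H *ᵥ x) := by
    have hkS : ∀ c : ℝ, 2 * c * (k ⬝ᵥ H *ᵥ k) ≤ μ * (k ⬝ᵥ H *ᵥ k + c ^ 2 * (x ⬝ᵥ H *ᵥ x)) := by
      intro c
      have h := (le_abs_self _).trans (hsec k (c • x))
      rw [← hHA, ← hHA] at h
      have e : k ⬝ᵥ (A - Aᵀ) *ᵥ (c • x) = 2 * c * (k ⬝ᵥ H *ᵥ k) := by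
        rw [hHk, hS, Matrix.mulVec_smul, Matrix.smul_mulVec, dotProduct_smul, dotProduct_smul,
          smul_eq_mul, smul_eq_mul]
        ring
      rw [e, Matrix.mulVec_smul, smul_dotProduct, dotProduct_smul, smul_eq_mul, smul_eq_mul] at h
      linarith
    -- c = μ is the useful scaling, but it says nothing when μ = 0; then c = 1 gives k·Hk ≤ 0.
    rcases hμ.eq_or_lt with h0 | h0
    · have := hkS 1
      rw [← h0] at this ⊢
      linarith
    · have := hkS μ
      have h2 : μ * (k ⬝ᵥ H *ᵥ k) ≤ μ * (μ ^ 2 * (x ⬝ᵥ H *ᵥ x)) := by linarith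
      exact le_of_mul_le_mul_left h2 h0
  have hAx : A *ᵥ x = H *ᵥ (x + (1 : ℝ) • k) := by
    rw [one_smul, Matrix.mulVec_add, hHk, ← Matrix.add_mulVec, ← hAHS]
  -- The cross term x·Hk = x·Sx vanishes by skew-symmetry, which yields 1 + μ² rather than (1 + μ)².
  have hcs := sq_bilin_le hHt hHnn u (x + (1 : ℝ) • k)
  rw [quadForm_add_smul hHt, hHk, hSx, ← hHk] at hcs
  rw [← hHA u, ← hHA x, hAx]
  have := mul_le_mul_of_nonneg_left hkk (hHnn u)
  nlinarith

/-- Real eigenpairs of the pencil `(Y A, P)`, where `Y` permutes coordinates by an involution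
`σ`. -/
theorem abs_mem_of_real_pencil {A P : Matrix ι ι ℝ} {σ : ι → ι} {μ : ℝ}
    (hσ : Function.Involutive σ) (hμ : 0 ≤ μ)
    (hPs : Pᵀ = P) (hPσ : ∀ i j, P (σ i) (σ j) = P i j) (hAσ : ∀ i j, A (σ i) (σ j) = A j i)
    (hlow : ∀ x, x ≠ 0 → 1 / 2 * (x ⬝ᵥ P *ᵥ x) < x ⬝ᵥ A *ᵥ x)
    (hupp : ∀ x, x ≠ 0 → x ⬝ᵥ A *ᵥ x < 3 / 2 * (x ⬝ᵥ P *ᵥ x))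
    (hsec : ∀ x y, |x ⬝ᵥ (A - Aᵀ) *ᵥ y| ≤ μ * (x ⬝ᵥ A *ᵥ x + y ⬝ᵥ A *ᵥ y))
    {x : ι → ℝ} (hx : x ≠ 0) {l : ℝ} (hl : (A *ᵥ x) ∘ σ = l • P *ᵥ x) :
    1 / 2 < |l| ∧ |l| < 3 / 2 * √(1 + μ ^ 2) := by
  have hPpos : ∀ x, x ≠ 0 → 0 < x ⬝ᵥ P *ᵥ x := fun x hx => by
    linarith [hlow x hx, hupp x hx]
  have hApos : ∀ x, x ≠ 0 → 0 < x ⬝ᵥ A *ᵥ x := fun x hx => by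
    linarith [hlow x hx, hPpos x hx]
  have hPnn : ∀ z, 0 ≤ z ⬝ᵥ P *ᵥ z := fun z => by
    by_cases hz : z = 0
    · simp [hz]
    · exact (hPpos z hz).le
  let e : ι ≃ ι := ⟨σ, σ, hσ, hσ⟩
  set u : ι → ℝ := x ∘ σ with hu
  have hdot : ∀ a b : ι → ℝ, (a ∘ σ) ⬝ᵥ (b ∘ σ) = a ⬝ᵥ b := fun a b =>
    Equiv.sum_comp e (fun i => a i * b i)
  have hσσ : ∀ a : ι → ℝ, (a ∘ σ) ∘ σ = a := fun a => by
    funext i; simp [hσ i]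
  have hPu : (P *ᵥ x) ∘ σ = P *ᵥ u := by
    funext i
    simp only [Matrix.mulVec, dotProduct, Function.comp, hu]
    rw [← Equiv.sum_comp e]
    exact Finset.sum_congr rfl fun j _ => by
      change P (σ i) (σ j) * x (σ j) = _
      rw [hPσ]
  have hAu : (Aᵀ *ᵥ x) ∘ σ = A *ᵥ u := by
    funext i
    simp only [Matrix.mulVec, dotProduct, Function.comp, hu]
    rw [← Equiv.sum_comp e]
    exact Finset.sum_congr rfl fun j _ => by
      change A (σ j) (σ i) * x (σ j) = _
      rw [hAσ]
  have hAx : A *ᵥ x = l • P *ᵥ u := by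
    rw [← hσσ (A *ᵥ x), hl, ← hPu]
    rfl
  have huPu : u ⬝ᵥ P *ᵥ u = x ⬝ᵥ P *ᵥ x := by rw [← hPu, hu, hdot]
  have huAu : u ⬝ᵥ A *ᵥ u = x ⬝ᵥ A *ᵥ x := by rw [← hAu, hu, hdot, bilin_transpose]
  have hX := hPpos x hx
  constructor
  · have h1 : x ⬝ᵥ A *ᵥ x = l * (x ⬝ᵥ P *ᵥ u) := by rw [hAx, dotProduct_smul, smul_eq_mul]
    have h2 := sq_bilin_le hPs hPnn x u
    rw [huPu] at h2
    have h3 : |x ⬝ᵥ P *ᵥ u| ≤ x ⬝ᵥ P *ᵥ x := abs_le_of_sq_le_sq (by linarith) hX.le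
    have h4 : x ⬝ᵥ A *ᵥ x ≤ |l| * (x ⬝ᵥ P *ᵥ x) := by
      rw [h1]
      calc _ ≤ |l * (x ⬝ᵥ P *ᵥ u)| := le_abs_self _
        _ = |l| * |x ⬝ᵥ P *ᵥ u| := abs_mul _ _
        _ ≤ _ := mul_le_mul_of_nonneg_left h3 (abs_nonneg _)
    exact lt_of_mul_lt_mul_right ((hlow x hx).trans_le h4) hX.le
  · have h1 : u ⬝ᵥ A *ᵥ x = l * (x ⬝ᵥ P *ᵥ x) := by
      rw [hAx, dotProduct_smul, smul_eq_mul, huPu]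
    have h2 := sq_bilin_le_of_sector hμ hApos hsec u x
    rw [huAu, h1] at h2
    have hE := hApos x hx
    have hr : 0 < √(1 + μ ^ 2) := Real.sqrt_pos.2 (by positivity)
    have hr2 : √(1 + μ ^ 2) ^ 2 = 1 + μ ^ 2 := Real.sq_sqrt (by positivity)
    have h3 : |l * (x ⬝ᵥ P *ᵥ x)| ≤ √(1 + μ ^ 2) * (x ⬝ᵥ A *ᵥ x) := by
      refine abs_le_of_sq_le_sq ?_ (by positivity)
      rw [mul_pow √_, hr2]
      linarith
    rw [abs_mul, abs_of_pos hX] at h3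
    have h4 := mul_lt_mul_of_pos_left (hupp x hx) hr
    refine lt_of_mul_lt_mul_right (a := x ⬝ᵥ P *ᵥ x) ?_ hX.le
    linarith

/-- Complex eigenvalues of `P⁻¹ N` for real symmetric `N` and positive definite `P` are real, with
real eigenvectors. -/
theorem exists_real_eigenpair {N P : Matrix ι ι ℝ} (hNs : Nᵀ = N) (hPs : Pᵀ = P)
    (hPpos : ∀ x, x ≠ 0 → 0 < x ⬝ᵥ P *ᵥ x) {z : ℂ}
    (hz : Module.End.HasEigenvalue (Matrix.toLin' ((P⁻¹ * N).map (fun x : ℝ => (x : ℂ)))) z) :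
    ∃ l : ℝ, z = l ∧ ∃ x : ι → ℝ, x ≠ 0 ∧ N *ᵥ x = l • P *ᵥ x := by
  obtain ⟨w, hw⟩ := hz.exists_hasEigenvector
  have hw0 := hw.2
  have hwz := hw.apply_eq_smul
  rw [Matrix.toLin'_apply] at hwz
  set a : ι → ℝ := fun i => (w i).re with ha
  set b : ι → ℝ := fun i => (w i).im with hb
  have hre : ∀ M : Matrix ι ι ℝ, ∀ i, ((M.map (fun x : ℝ => (x : ℂ))) *ᵥ w) i =
      ⟨(M *ᵥ a) i, (M *ᵥ b) i⟩ := fun M i => by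
    apply Complex.ext <;> simp [Matrix.mulVec, dotProduct, ha, hb]
  have hunit := isUnit_det_of_quadForm_pos hPpos
  have e1 : (P⁻¹ * N) *ᵥ a = z.re • a - z.im • b := by
    funext i
    have := congrArg Complex.re (congrFun hwz i)
    rw [hre] at this
    simpa using this
  have e2 : (P⁻¹ * N) *ᵥ b = z.re • b + z.im • a := by
    funext i
    have := congrArg Complex.im (congrFun hwz i)
    rw [hre] at this
    simpa using this
  have key : ∀ v, P *ᵥ ((P⁻¹ * N) *ᵥ v) = N *ᵥ v := fun v => by
    rw [Matrix.mulVec_mulVec, ← mul_assoc, Matrix.mul_nonsing_inv _ hunit, one_mul]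
  have f1 := key a
  have f2 := key b
  rw [e1, Matrix.mulVec_sub, Matrix.mulVec_smul, Matrix.mulVec_smul] at f1
  rw [e2, Matrix.mulVec_add, Matrix.mulVec_smul, Matrix.mulVec_smul] at f2
  -- Symmetry of N and P applied to the real and imaginary parts a, b of the eigenvector leaves Im z
  -- · (a·Pa + b·Pb) = 0.
  have hPab : b ⬝ᵥ P *ᵥ a = a ⬝ᵥ P *ᵥ b := by rw [← bilin_transpose, hPs]
  have hNab : b ⬝ᵥ N *ᵥ a = a ⬝ᵥ N *ᵥ b := by rw [← bilin_transpose, hNs]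
  rw [← f1, ← f2] at hNab
  simp only [dotProduct_add, dotProduct_sub, dotProduct_smul, smul_eq_mul, hPab] at hNab
  have hnn : ∀ z, 0 ≤ z ⬝ᵥ P *ᵥ z := fun z => by
    by_cases hz : z = 0
    · simp [hz]
    · exact (hPpos z hz).le
  have hab : a ≠ 0 ∨ b ≠ 0 := by
    by_contra! h
    exact hw0 (funext fun i => Complex.ext (congrFun h.1 i) (congrFun h.2 i))
  have him : z.im = 0 := by
    have hs : 0 < a ⬝ᵥ P *ᵥ a + b ⬝ᵥ P *ᵥ b := by
      rcases hab with h | h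
      · linarith [hPpos a h, hnn b]
      · linarith [hPpos b h, hnn a]
    have : z.im * (a ⬝ᵥ P *ᵥ a + b ⬝ᵥ P *ᵥ b) = 0 := by linarith
    exact (mul_eq_zero.1 this).resolve_right hs.ne'
  rw [him, zero_smul] at f1 f2
  refine ⟨z.re, Complex.ext rfl him, ?_⟩
  rcases hab with h | h
  · exact ⟨a, h, by rw [← f1, sub_zero]⟩
  · exact ⟨b, h, by rw [← f2, add_zero]⟩

end Abstract

/-! ### Kronecker products on multi-indices. -/

section Kronecker

variable {d : ℕ} {n : Fin d → ℕ}

theorem kron_apply (B : ∀ i, Matrix (Fin (n i)) (Fin (n i)) ℝ) (p q : ∀ i, Fin (n i)) :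
    kron B p q = ∏ i, B i (p i) (q i) := rfl

theorem kronAt_apply (i : Fin d) (B : Matrix (Fin (n i)) (Fin (n i)) ℝ) (p q : ∀ i, Fin (n i)) :
    kronAt i B p q = ∏ j, (Function.update (fun _ => 1) i B :
      ∀ j, Matrix (Fin (n j)) (Fin (n j)) ℝ) j (p j) (q j) := rfl

/-- Row p is supported on the multi-indices that agree with p outside coordinate i. -/
theorem kronAt_mulVec (i : Fin d) (B : Matrix (Fin (n i)) (Fin (n i)) ℝ)
    (y : (∀ i, Fin (n i)) → ℝ) (p : ∀ i, Fin (n i)) :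
    (kronAt i B *ᵥ y) p = ∑ b, B (p i) b * y (Function.update p i b) := by
  refine (Fintype.sum_of_injective (Function.update p i) (Function.update_injective p i) _ _
    (fun q hq => ?_) fun b => ?_).symm
  · have : ∃ j, j ≠ i ∧ p j ≠ q j := by
      by_contra! h
      refine hq ⟨q i, ?_⟩
      rw [Function.update_eq_iff]
      exact ⟨rfl, fun j hj => h j hj⟩
    obtain ⟨j, hji, hj⟩ := this
    have h0 : kronAt i B p q = 0 := by
      rw [kronAt_apply]
      refine Finset.prod_eq_zero (Finset.mem_univ j) ?_
      rw [Function.update_of_ne hji, Matrix.one_apply_ne hj]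
    exact mul_eq_zero_of_left h0 _
  · have h1 : kronAt i B p (Function.update p i b) = B (p i) b := by
      rw [kronAt_apply, Finset.prod_eq_single i (fun j _ hj => ?_) fun h =>
        absurd (Finset.mem_univ i) h]
      · rw [Function.update_self, Function.update_self]
      · rw [Function.update_of_ne hj, Function.update_of_ne hj, Matrix.one_apply_eq]
    exact congrArg (· * _) h1.symm

/-- The multi-index with `i`-th entry `a` and other entries `r`. -/
def insertAt (i : Fin d) (r : ∀ j : {j // j ≠ i}, Fin (n j)) (a : Fin (n i)) : ∀ j, Fin (n j) :=
  (Equiv.piSplitAt i fun j => Fin (n j)).symm (a, r)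

theorem insertAt_self (i : Fin d) (r : ∀ j : {j // j ≠ i}, Fin (n j)) (a : Fin (n i)) :
    insertAt i r a i = a := by
  simp [insertAt, Equiv.piSplitAt]

theorem update_insertAt (i : Fin d) (r : ∀ j : {j // j ≠ i}, Fin (n j)) (a b : Fin (n i)) :
    Function.update (insertAt i r a) i b = insertAt i r b := by
  rw [Function.update_eq_iff]
  refine ⟨(insertAt_self i r b).symm, fun j hj => ?_⟩
  simp [insertAt, Equiv.piSplitAt, hj]

/-- Slicing along direction i carries every one-dimensional form inequality over to the multilevel
matrices. -/
theorem kronAt_bilin (i : Fin d) (B : Matrix (Fin (n i)) (Fin (n i)) ℝ)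
    (x y : (∀ i, Fin (n i)) → ℝ) :
    x ⬝ᵥ kronAt i B *ᵥ y =
      ∑ r, (fun a => x (insertAt i r a)) ⬝ᵥ B *ᵥ (fun a => y (insertAt i r a)) := by
  rw [dotProduct]
  simp only [kronAt_mulVec]
  rw [← Equiv.sum_comp (Equiv.piSplitAt i fun j => Fin (n j)).symm, Fintype.sum_prod_type_right]
  refine Finset.sum_congr rfl fun r _ => Finset.sum_congr rfl fun a _ => ?_
  change x (insertAt i r a) * ∑ b, B (insertAt i r a i) b *
    y (Function.update (insertAt i r a) i b) = _
  simp only [insertAt_self, update_insertAt]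
  rfl

theorem kronAt_transpose (i : Fin d) (B : Matrix (Fin (n i)) (Fin (n i)) ℝ) :
    (kronAt i B)ᵀ = kronAt i Bᵀ := by
  ext p q
  rw [Matrix.transpose_apply, kronAt_apply, kronAt_apply]
  refine Finset.prod_congr rfl fun j _ => ?_
  by_cases h : j = i
  · subst h; simp
  · simp [Function.update_of_ne h, Matrix.one_apply, eq_comm]

/-- The reversal of every index. -/
def revIndex (p : ∀ i, Fin (n i)) : ∀ i, Fin (n i) := fun i => (p i).rev

theorem revIndex_involutive : Function.Involutive (revIndex (n := n)) := fun p => by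
  funext i; simp [revIndex]

theorem kronAt_revIndex (i : Fin d) (B C : Matrix (Fin (n i)) (Fin (n i)) ℝ)
    (h : ∀ j k, B j.rev k.rev = C j k) (p q : ∀ i, Fin (n i)) :
    kronAt i B (revIndex p) (revIndex q) = kronAt i C p q := by
  rw [kronAt_apply, kronAt_apply]
  refine Finset.prod_congr rfl fun j _ => ?_
  by_cases hj : j = i
  · subst hj; simp [revIndex, h]
  · simp [Function.update_of_ne hj, Matrix.one_apply, revIndex]

theorem one_revIndex (p q : ∀ i, Fin (n i)) :
    (1 : Matrix (∀ i, Fin (n i)) (∀ i, Fin (n i)) ℝ) (revIndex p) (revIndex q) =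
      (1 : Matrix (∀ i, Fin (n i)) (∀ i, Fin (n i)) ℝ) p q := by
  simp [Matrix.one_apply, revIndex_involutive.injective.eq_iff]

theorem multiAntiIdentity_apply (p q : ∀ i, Fin (n i)) :
    multiAntiIdentity n p q = if q = revIndex p then 1 else 0 := by
  have key : ∀ i, (antiIdentity (n i)) (p i) (q i) = if q i = (p i).rev then 1 else 0 := by
    intro i
    have := (p i).2
    simp only [antiIdentity, Matrix.of_apply, Fin.ext_iff, Fin.val_rev]
    congr 1
    rw [eq_iff_iff]
    omega
  rw [multiAntiIdentity, kron_apply]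
  split_ifs with h
  · refine Finset.prod_eq_one fun i _ => ?_
    exact (key i).trans (if_pos (congrFun h i))
  · obtain ⟨i, hi⟩ : ∃ i, q i ≠ (p i).rev := by
      by_contra! h'
      exact h (funext h')
    refine Finset.prod_eq_zero (Finset.mem_univ i) ?_
    exact (key i).trans (if_neg hi)

theorem multiAntiIdentity_mulVec (v : (∀ i, Fin (n i)) → ℝ) :
    multiAntiIdentity n *ᵥ v = v ∘ revIndex := by
  funext p
  simp [Matrix.mulVec, dotProduct, multiAntiIdentity_apply]

theorem multiAntiIdentity_mul_apply (A : Matrix (∀ i, Fin (n i)) (∀ i, Fin (n i)) ℝ)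
    (p q : ∀ i, Fin (n i)) : (multiAntiIdentity n * A) p q = A (revIndex p) q := by
  simp [Matrix.mul_apply, multiAntiIdentity_apply]

end Kronecker

/-! ### Form bounds, sector and symmetries of the multilevel matrices. -/

theorem dotProduct_sum_smul_mulVec {ι κ : Type*} [Fintype ι] [Fintype κ] (c : κ → ℝ)
    (B : κ → Matrix ι ι ℝ) (x y : ι → ℝ) :
    x ⬝ᵥ (∑ i, c i • B i) *ᵥ y = ∑ i, c i * (x ⬝ᵥ B i *ᵥ y) := by
  simp only [Matrix.sum_mulVec, dotProduct_sum, Matrix.smul_mulVec, dotProduct_smul, smul_eq_mul]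

namespace Problem

variable {d : ℕ} (p : Problem d) (n : Fin d → ℕ) (M : ℕ)

theorem tauPrecond_bilin (x y : (∀ i, Fin (n i)) → ℝ) :
    x ⬝ᵥ p.tauPrecond n M *ᵥ y = p.nu M * (x ⬝ᵥ y) + ∑ i, (p.vPlus n i + p.vMinus n i) *
      (x ⬝ᵥ kronAt i (tau (symmPart (grunwaldMatrix (p.α i) (n i)))) *ᵥ y) := by
  rw [tauPrecond, Matrix.add_mulVec, dotProduct_add, dotProduct_sum_smul_mulVec,
    Matrix.smul_mulVec, Matrix.one_mulVec, dotProduct_smul, smul_eq_mul]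

theorem coeffMatrix_bilin (x y : (∀ i, Fin (n i)) → ℝ) :
    x ⬝ᵥ p.coeffMatrix n M *ᵥ y = p.nu M * (x ⬝ᵥ y) + ∑ i,
      (p.vPlus n i * (x ⬝ᵥ kronAt i (grunwaldMatrix (p.α i) (n i)) *ᵥ y) +
        p.vMinus n i * (y ⬝ᵥ kronAt i (grunwaldMatrix (p.α i) (n i)) *ᵥ x)) := by
  rw [coeffMatrix, Matrix.add_mulVec, dotProduct_add, Finset.sum_add_distrib, Matrix.add_mulVec,
    dotProduct_add, dotProduct_sum_smul_mulVec, dotProduct_sum_smul_mulVec, Matrix.smul_mulVec,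
    Matrix.one_mulVec, dotProduct_smul, smul_eq_mul, Finset.sum_add_distrib]
  simp only [bilin_transpose]

theorem tauPrecond_transpose : (p.tauPrecond n M)ᵀ = p.tauPrecond n M := by
  have h : ∀ i, (tau (symmPart (grunwaldMatrix (p.α i) (n i))))ᵀ =
      tau (symmPart (grunwaldMatrix (p.α i) (n i))) := fun i => by
    ext j k; exact tau_grunwaldMatrix_symm _ _ _
  simp only [tauPrecond, Matrix.transpose_add, Matrix.transpose_smul, Matrix.transpose_one,
    Matrix.transpose_sum, kronAt_transpose, h]

theorem tauPrecond_revIndex (r s : ∀ i, Fin (n i)) :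
    p.tauPrecond n M (revIndex r) (revIndex s) = p.tauPrecond n M r s := by
  simp only [tauPrecond, Matrix.add_apply, Matrix.smul_apply, Matrix.sum_apply, one_revIndex]
  congr 1
  exact Finset.sum_congr rfl fun i _ => by
    rw [kronAt_revIndex i _ _ fun j k => tau_grunwaldMatrix_rev _ j k]

theorem coeffMatrix_revIndex (r s : ∀ i, Fin (n i)) :
    p.coeffMatrix n M (revIndex r) (revIndex s) = p.coeffMatrix n M s r := by
  simp only [coeffMatrix, Matrix.add_apply, Matrix.smul_apply, Matrix.sum_apply, one_revIndex,
    Matrix.transpose_apply]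
  rw [← Matrix.transpose_apply 1, Matrix.transpose_one]
  congr 1
  refine Finset.sum_congr rfl fun i _ => ?_
  have h := kronAt_revIndex i (grunwaldMatrix (p.α i) (n i)) (grunwaldMatrix (p.α i) (n i))ᵀ
    fun j k => grunwaldMatrix_rev _ j k
  rw [h, h, ← kronAt_transpose, Matrix.transpose_apply, Matrix.transpose_apply]

variable {p n M}

theorem quadForm_bounds (hα : ∀ i, 1 < p.α i ∧ p.α i < 2) (hv : ∀ i, 0 ≤ p.vPlus n i + p.vMinus n i)
    (hν : 0 < p.nu M) {x : (∀ i, Fin (n i)) → ℝ} (hx : x ≠ 0) :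
    1 / 2 * (x ⬝ᵥ p.tauPrecond n M *ᵥ x) < x ⬝ᵥ p.coeffMatrix n M *ᵥ x ∧
      x ⬝ᵥ p.coeffMatrix n M *ᵥ x < 3 / 2 * (x ⬝ᵥ p.tauPrecond n M *ᵥ x) := by
  -- The spatial terms satisfy only weak inequalities; the term in ν makes both strict.
  have hxx : 0 < p.nu M * (x ⬝ᵥ x) := by
    refine mul_pos hν (lt_of_le_of_ne ?_ (Ne.symm (dotProduct_self_eq_zero.not.2 hx)))
    exact Finset.sum_nonneg fun i _ => mul_self_nonneg _
  rw [tauPrecond_bilin, coeffMatrix_bilin]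
  have key : ∀ i, 1 / 2 * (x ⬝ᵥ kronAt i (tau (symmPart (grunwaldMatrix (p.α i) (n i)))) *ᵥ x) ≤
      x ⬝ᵥ kronAt i (grunwaldMatrix (p.α i) (n i)) *ᵥ x ∧
      x ⬝ᵥ kronAt i (grunwaldMatrix (p.α i) (n i)) *ᵥ x ≤
        3 / 2 * (x ⬝ᵥ kronAt i (tau (symmPart (grunwaldMatrix (p.α i) (n i)))) *ᵥ x) := fun i => by
    simp only [kronAt_bilin, Finset.mul_sum]
    exact ⟨Finset.sum_le_sum fun r _ => (tau_grunwaldMatrix_bounds (hα i).1 (hα i).2 _).1,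
      Finset.sum_le_sum fun r _ => (tau_grunwaldMatrix_bounds (hα i).1 (hα i).2 _).2⟩
  simp only [← add_mul]
  have l1 := Finset.sum_le_sum fun i (_ : i ∈ Finset.univ) =>
    mul_le_mul_of_nonneg_left (key i).1 (hv i)
  have l2 := Finset.sum_le_sum fun i (_ : i ∈ Finset.univ) =>
    mul_le_mul_of_nonneg_left (key i).2 (hv i)
  simp only [mul_left_comm _ (1 / 2 : ℝ), mul_left_comm _ (3 / 2 : ℝ), ← Finset.mul_sum] at l1 l2
  constructor <;> linarith

theorem kronAt_grunwaldMatrix_nonneg {α : ℝ} (h1 : 1 < α) (h2 : α < 2) (i : Fin d)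
    (x : (∀ i, Fin (n i)) → ℝ) : 0 ≤ x ⬝ᵥ kronAt i (grunwaldMatrix α (n i)) *ᵥ x := by
  rw [kronAt_bilin]
  refine Finset.sum_nonneg fun r _ => ?_
  have := tau_grunwaldMatrix_bounds h1 h2 fun a => x (insertAt i r a)
  linarith [this.1, this.2]

theorem kronAt_grunwaldMatrix_sector {α : ℝ} (h1 : 1 < α) (h2 : α < 2) (i : Fin d)
    (x y : (∀ i, Fin (n i)) → ℝ) :
    |x ⬝ᵥ kronAt i (grunwaldMatrix α (n i)) *ᵥ y - y ⬝ᵥ kronAt i (grunwaldMatrix α (n i)) *ᵥ x| ≤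
      |Real.tan (α / 2 * Real.pi)| * (x ⬝ᵥ kronAt i (grunwaldMatrix α (n i)) *ᵥ x +
        y ⬝ᵥ kronAt i (grunwaldMatrix α (n i)) *ᵥ y) := by
  simp only [kronAt_bilin]
  rw [← Finset.sum_sub_distrib, ← Finset.sum_add_distrib, Finset.mul_sum]
  refine (Finset.abs_sum_le_sum_abs _ _).trans (Finset.sum_le_sum fun r _ => ?_)
  have := grunwaldMatrix_sector h1 h2 (fun a => x (insertAt i r a)) fun a => y (insertAt i r a)
  rwa [Matrix.sub_mulVec, dotProduct_sub, bilin_transpose] at this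

theorem coeffMatrix_sector {μ : ℝ} (hμ0 : 0 ≤ μ) (hα : ∀ i, 1 < p.α i ∧ p.α i < 2)
    (hν : 0 < p.nu M)
    (hμ : ∀ i, |p.vPlus n i - p.vMinus n i| * |Real.tan (p.α i / 2 * Real.pi)| ≤
      μ * (p.vPlus n i + p.vMinus n i)) (x y : (∀ i, Fin (n i)) → ℝ) :
    |x ⬝ᵥ (p.coeffMatrix n M - (p.coeffMatrix n M)ᵀ) *ᵥ y| ≤
      μ * (x ⬝ᵥ p.coeffMatrix n M *ᵥ x + y ⬝ᵥ p.coeffMatrix n M *ᵥ y) := by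
  have hnn : ∀ z : (∀ i, Fin (n i)) → ℝ, 0 ≤ p.nu M * (z ⬝ᵥ z) := fun z =>
    mul_nonneg hν.le (Finset.sum_nonneg fun i _ => mul_self_nonneg _)
  rw [Matrix.sub_mulVec, dotProduct_sub, bilin_transpose]
  simp only [coeffMatrix_bilin]
  rw [dotProduct_comm y x, add_sub_add_left_eq_sub, ← Finset.sum_sub_distrib]
  have step : |∑ i, ((p.vPlus n i * (x ⬝ᵥ kronAt i (grunwaldMatrix (p.α i) (n i)) *ᵥ y) +
        p.vMinus n i * (y ⬝ᵥ kronAt i (grunwaldMatrix (p.α i) (n i)) *ᵥ x)) -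
      (p.vPlus n i * (y ⬝ᵥ kronAt i (grunwaldMatrix (p.α i) (n i)) *ᵥ x) +
        p.vMinus n i * (x ⬝ᵥ kronAt i (grunwaldMatrix (p.α i) (n i)) *ᵥ y)))| ≤
      ∑ i, μ * ((p.vPlus n i * (x ⬝ᵥ kronAt i (grunwaldMatrix (p.α i) (n i)) *ᵥ x) +
        p.vMinus n i * (x ⬝ᵥ kronAt i (grunwaldMatrix (p.α i) (n i)) *ᵥ x)) +
      (p.vPlus n i * (y ⬝ᵥ kronAt i (grunwaldMatrix (p.α i) (n i)) *ᵥ y) +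
        p.vMinus n i * (y ⬝ᵥ kronAt i (grunwaldMatrix (p.α i) (n i)) *ᵥ y))) := by
    refine (Finset.abs_sum_le_sum_abs _ _).trans (Finset.sum_le_sum fun i _ => ?_)
    have hs := kronAt_grunwaldMatrix_sector (hα i).1 (hα i).2 i x y
    have hx := kronAt_grunwaldMatrix_nonneg (hα i).1 (hα i).2 i x
    have hy := kronAt_grunwaldMatrix_nonneg (hα i).1 (hα i).2 i y
    -- The skew part of v₊W + v₋Wᵀ carries the factor v₊ - v₋, its symmetric part v₊ + v₋; this is
    -- the quotient in μ.
    have h1 := mul_le_mul_of_nonneg_left hs (abs_nonneg (p.vPlus n i - p.vMinus n i))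
    have h2 := mul_le_mul_of_nonneg_right (hμ i) (add_nonneg hx hy)
    rw [← abs_mul] at h1
    refine le_trans (le_of_eq ?_) (h1.trans (le_trans (le_of_eq ?_) (h2.trans (le_of_eq ?_))))
    · congr 1; ring
    · ring
    · ring
  refine step.trans ?_
  rw [← Finset.mul_sum, Finset.sum_add_distrib]
  refine mul_le_mul_of_nonneg_left ?_ hμ0
  linarith [hnn x, hnn y]

theorem h_pos (n : Fin d → ℕ) {i : Fin d} (hab : p.a i < p.b i) : 0 < p.h n i :=
  div_pos (sub_pos.2 hab) (by positivity)

theorem nu_pos (hT : 0 < p.T) (hM : 1 ≤ M) : 0 < p.nu M := by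
  have : (0 : ℝ) < M := by exact_mod_cast hM
  unfold nu timeStep
  positivity

end Problem

theorem epsBound_term_le {d : ℕ} (α dPlus dMinus : Fin d → ℝ) (i : Fin d) :
    |dPlus i - dMinus i| / (dPlus i + dMinus i) * |Real.tan (α i / 2 * Real.pi)| ≤
      epsBound α dPlus dMinus :=
  le_ciSup (f := fun i => |dPlus i - dMinus i| / (dPlus i + dMinus i) *
    |Real.tan (α i / 2 * Real.pi)|) (Set.finite_range _).bddAbove i

end FracDiff

end

/-! ### Choice of ε and conclusion. -/

theorem mainTheorem9 (d : ℕ) (hd : 1 ≤ d) (α dPlus dMinus : Fin d → ℝ)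
    (hα : ∀ i, 1 < α i ∧ α i < 2)
    (hPlus : ∀ i, 0 ≤ dPlus i) (hMinus : ∀ i, 0 ≤ dMinus i)
    (hsum : ∀ i, 0 < dPlus i + dMinus i) :
    ∃ ε : ℝ, 0 ≤ ε ∧ ε ≤ FracDiff.epsBound α dPlus dMinus ∧
      (0 < FracDiff.epsBound α dPlus dMinus → ε < FracDiff.epsBound α dPlus dMinus) ∧
      ∀ (p : FracDiff.Problem d) (n : Fin d → ℕ) (M : ℕ),
        p.α = α → p.dPlus = dPlus → p.dMinus = dMinus →
        (∀ i, p.a i < p.b i) → 0 < p.T → (∀ i, 1 ≤ n i) → 1 ≤ M →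
        IsUnit (p.tauPrecond n M).det ∧
        ∀ z : ℂ,
          Module.End.HasEigenvalue
            (Matrix.toLin' (((p.tauPrecond n M)⁻¹ * FracDiff.multiAntiIdentity n *
              p.coeffMatrix n M).map (fun x : ℝ => (x : ℂ)))) z →
          ∃ x : ℝ, z = (x : ℂ) ∧
            x ∈ Set.Ioo (-(3 / 2 * (1 + ε))) (-(1 / 2)) ∪ Set.Ioo (1 / 2) (3 / 2 * (1 + ε)) := by
  set μ := FracDiff.epsBound α dPlus dMinus with hμ
  have hμ0 : 0 ≤ μ :=
    le_trans (mul_nonneg (div_nonneg (abs_nonneg _) (hsum ⟨0, hd⟩).le) (abs_nonneg _))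
      (FracDiff.epsBound_term_le α dPlus dMinus ⟨0, hd⟩)
  -- This makes 1 + ε = √(1 + μ²), which is at most 1 + μ, strictly less when μ > 0.
  refine ⟨√(1 + μ ^ 2) - 1, ?_, ?_, fun h => ?_, ?_⟩
  · rw [sub_nonneg, Real.one_le_sqrt]
    nlinarith
  · rw [sub_le_iff_le_add, Real.sqrt_le_iff]
    constructor <;> nlinarith
  · rw [sub_lt_iff_lt_add, Real.sqrt_lt' (by linarith)]
    nlinarith
  rintro p n M rfl rfl rfl hab hT - hM
  have hν := FracDiff.Problem.nu_pos hT hM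
  have hpow : ∀ i, 0 < p.h n i ^ p.α i := fun i =>
    Real.rpow_pos_of_pos (FracDiff.Problem.h_pos n (hab i)) _
  have hv : ∀ i, 0 ≤ p.vPlus n i + p.vMinus n i := fun i =>
    add_nonneg (div_nonneg (hPlus i) (hpow i).le) (div_nonneg (hMinus i) (hpow i).le)
  have hb := fun x hx => FracDiff.Problem.quadForm_bounds (n := n) hα hv hν (x := x) hx
  have hPpos : ∀ x, x ≠ 0 → 0 < dotProduct x (p.tauPrecond n M |>.mulVec x) := fun x hx => by
    linarith [(hb x hx).1, (hb x hx).2]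
  -- The common factor h_i^{α_i} cancels, so μ, and with it ε, does not depend on the grid.
  have hsec := FracDiff.Problem.coeffMatrix_sector (n := n) (M := M) hμ0 hα hν fun i => by
    have h := FracDiff.epsBound_term_le p.α p.dPlus p.dMinus i
    rw [div_mul_eq_mul_div, div_le_iff₀ (hsum i)] at h
    rw [FracDiff.Problem.vPlus, FracDiff.Problem.vMinus, ← sub_div, ← add_div, abs_div,
      abs_of_pos (hpow i), div_mul_eq_mul_div, mul_div_assoc']
    exact div_le_div_of_nonneg_right h (hpow i).le
  refine ⟨FracDiff.isUnit_det_of_quadForm_pos hPpos, fun z hz => ?_⟩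
  rw [mul_assoc] at hz
  have hN : (FracDiff.multiAntiIdentity n * p.coeffMatrix n M).transpose =
      FracDiff.multiAntiIdentity n * p.coeffMatrix n M := by
    ext r s
    rw [Matrix.transpose_apply, FracDiff.multiAntiIdentity_mul_apply,
      FracDiff.multiAntiIdentity_mul_apply, ← FracDiff.Problem.coeffMatrix_revIndex,
      FracDiff.revIndex_involutive s]
  obtain ⟨l, rfl, x, hx, hl⟩ :=
    FracDiff.exists_real_eigenpair hN (p.tauPrecond_transpose n M) hPpos hz
  rw [← Matrix.mulVec_mulVec, FracDiff.multiAntiIdentity_mulVec] at hl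
  obtain ⟨h1, h2⟩ := FracDiff.abs_mem_of_real_pencil FracDiff.revIndex_involutive hμ0
    (p.tauPrecond_transpose n M) (p.tauPrecond_revIndex n M) (p.coeffMatrix_revIndex n M)
    (fun x hx => (hb x hx).1) (fun x hx => (hb x hx).2) hsec hx hl
  refine ⟨l, rfl, ?_⟩
  rw [add_sub_cancel]
  obtain ⟨h3, h4⟩ := abs_lt.1 h2
  rcases lt_abs.1 h1 with h | h
  · exact Or.inr ⟨h, h4⟩
  · exact Or.inl ⟨h3, by linarith⟩
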